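/- Let $\beta=(\beta_n)_{n\ge 0}$ be a sequence of positive numbers and let $H=H^\beta(\mathbb{D})$ be a complex Hilbert space of analytic functions on the open unit disc $\mathbb{D}$ such that all evaluations $f\mapsto f(z)$, $z\in\mathbb{D}$, are continuous on $H$ and the functions $e_n(z)=\beta_n z^n$, $n\ge 0$, form an orthonormal basis of $H$. Let $\varphi,\psi$ be non-zero analytic functions on $\mathbb{D}$ for which the multiplication operators $M_\varphi f=\varphi f$ and $M_\psi f=\psi f$ are bounded on $H$. Suppose that at least one of $\varphi,\psi$ is non-constant and that $|\varphi(z)\psi(w)|=1$ for some $z,w\in\mathbb{D}$. Then the map $$C_{M_\varphi^*,M_\psi}(S)=M_\varphi^*\,S\,M_\psi$$ is frequently hypercyclic on each of the following spaces: 1. the Schatten--von Neumann class $S_p(H)$, for every $1\le p<\infty$, that is, the space of bounded operators $T$ on $H$ whose approximation numbers $a_n(T)=\inf\{\|T-F\|:\operatorname{rank}F<n\}$, $n\ge1$, are $p$-summable, with the norm $\|T\|_p=\big(\sum_{n\ge 1}a_n(T)^p\big)^{1/p}$; 2. the space $\mathcal{K}(H)$ of compact operators on $H$, with the operator norm; 3.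 the space $\mathcal{L}(H)$ of bounded operators on $H$, with the topology of uniform convergence on compact subsets of $H$. Here a continuous linear map $T$ on a topological vector space $X$ is called frequently hypercyclic if there is an $x\in X$ such that for every non-empty open set $U\subset X$ the set $A=\{n\in\mathbb{N}: T^nx\in U\}$ has positive lower density, that is, $\liminf_{N\to\infty}\frac1N\operatorname{card}\{n\in A: n\le N\}>0$. -/

import Mathlib

open scoped Complex.UnitDisc CompactConvergenceCLM

noncomputable section

/-! ### Frequent hypercyclicity -/

/-- The lower density `liminf_{N → ∞} card {n ∈ A : 1 ≤ n ≤ N} / N` of a set `A` of natural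
numbers. -/
def lowerDensity (A : Set ℕ) : ℝ :=
  Filter.liminf (fun N : ℕ => ((A ∩ Set.Icc 1 N).ncard : ℝ) / (N : ℝ)) Filter.atTop

/-- A linear map `T` on `X` is frequently hypercyclic if it is continuous and there is a vector `x`
such that `{n : T ^ n x ∈ U}` has positive lower density for every nonempty open set `U`. -/
def IsFrequentlyHypercyclic {X : Type*} [AddCommGroup X] [Module ℂ X] [TopologicalSpace X]
    (T : X →ₗ[ℂ] X) : Prop :=
  Continuous T ∧ ∃ x : X, ∀ U : Set X, IsOpen U → U.Nonempty →
    0 < lowerDensity {n : ℕ | (T ^ n) x ∈ U}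

/-! ### The two-sided multiplication on all bounded and on compact operators -/

section Operators

variable {H : Type*} [NormedAddCommGroup H] [InnerProductSpace ℂ H]

/-- The map `S ↦ R S T` on the space of bounded operators with the topology of uniform convergence
on compact sets. -/
def conjCOT (R T : H →L[ℂ] H) : (H →L_c[ℂ] H) →ₗ[ℂ] (H →L_c[ℂ] H) :=
  ((ContinuousLinearMap.postcompCompactConvergenceCLM H R).comp
    (ContinuousLinearMap.precompCompactConvergenceCLM H T)).toLinearMap

/-- The map `S ↦ R S T` on the bounded operators. -/
def conjOp (R T : H →L[ℂ] H) : (H →L[ℂ] H) →ₗ[ℂ] (H →L[ℂ] H) where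
  toFun S := R ∘L S ∘L T
  map_add' S S' := by ext x; simp
  map_smul' c S := by ext x; simp

theorem conjOp_mem_compactOperator (R T : H →L[ℂ] H) :
    ∀ S ∈ compactOperator (RingHom.id ℂ) H H, conjOp R T S ∈ compactOperator (RingHom.id ℂ) H H :=
  fun _ hS => (IsCompactOperator.comp_clm hS T).clm_comp R

/-- The map `S ↦ R S T` on the space of compact operators (with the operator norm). -/
def conjCompact (R T : H →L[ℂ] H) :
    compactOperator (RingHom.id ℂ) H H →ₗ[ℂ] compactOperator (RingHom.id ℂ) H H :=
  (conjOp R T).restrict (conjOp_mem_compactOperator R T)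

/-! ### Schatten-von Neumann classes -/

/-- The approximation number `a_n(T) = inf {‖T - F‖ : rank F < n}`, for `n ≥ 1`. -/
def approxNumber (n : ℕ) (T : H →L[ℂ] H) : ℝ :=
  sInf {r : ℝ | ∃ F : H →L[ℂ] H, LinearMap.rank (F : H →ₗ[ℂ] H) < (n : Cardinal) ∧ r = ‖T - F‖}

theorem approxNumber_le {n : ℕ} {T F : H →L[ℂ] H}
    (hF : LinearMap.rank (F : H →ₗ[ℂ] H) < (n : Cardinal)) : approxNumber n T ≤ ‖T - F‖ :=
  csInf_le ⟨0, by rintro _ ⟨F, -, rfl⟩; exact norm_nonneg _⟩ ⟨F, hF, rfl⟩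

theorem approxNumber_nonneg (n : ℕ) (T : H →L[ℂ] H) : 0 ≤ approxNumber n T :=
  Real.sInf_nonneg (by rintro _ ⟨F, -, rfl⟩; exact norm_nonneg _)

theorem exists_approx {n : ℕ} (T : H →L[ℂ] H) {c : ℝ} (hc : approxNumber (n + 1) T < c) :
    ∃ F : H →L[ℂ] H, LinearMap.rank (F : H →ₗ[ℂ] H) < ((n + 1 : ℕ) : Cardinal) ∧ ‖T - F‖ < c := by
  obtain ⟨_, ⟨F, hF, rfl⟩, h⟩ := exists_lt_of_csInf_lt
    (s := {r : ℝ | ∃ F : H →L[ℂ] H,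
      LinearMap.rank (F : H →ₗ[ℂ] H) < ((n + 1 : ℕ) : Cardinal) ∧ r = ‖T - F‖})
    ⟨_, 0, by simp, rfl⟩ hc
  exact ⟨F, hF, h⟩

theorem approxNumber_succ_le (n : ℕ) (T : H →L[ℂ] H) :
    approxNumber (n + 2) T ≤ approxNumber (n + 1) T := by
  refine le_of_forall_gt_imp_ge_of_dense fun c hc => ?_
  obtain ⟨F, hF, h⟩ := exists_approx T hc
  exact (approxNumber_le (hF.trans (by norm_cast; omega))).trans h.le

theorem approxNumber_conjOp_le (R T S : H →L[ℂ] H) (n : ℕ) :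
    approxNumber (n + 1) (conjOp R T S) ≤ ‖R‖ * ‖T‖ * approxNumber (n + 1) S := by
  refine ge_of_tendsto' (f := fun k : ℕ => ‖R‖ * ‖T‖ * (approxNumber (n + 1) S + 1 / (k + 1)))
    (x := Filter.atTop) ?_ fun k => ?_
  · simpa using (tendsto_one_div_add_atTop_nhds_zero_nat.const_add
      (approxNumber (n + 1) S)).const_mul (‖R‖ * ‖T‖)
  · obtain ⟨F, hF, h⟩ := exists_approx S
      (lt_add_of_pos_right (approxNumber (n + 1) S) (Nat.one_div_pos_of_nat (n := k) (α := ℝ)))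
    have hr : LinearMap.rank ((R ∘L F ∘L T : H →L[ℂ] H) : H →ₗ[ℂ] H) < ((n + 1 : ℕ) : Cardinal) :=
      ((LinearMap.rank_comp_le_right ((F : H →ₗ[ℂ] H) ∘ₗ (T : H →ₗ[ℂ] H)) (R : H →ₗ[ℂ] H)).trans
        (LinearMap.rank_comp_le_left (T : H →ₗ[ℂ] H) (F : H →ₗ[ℂ] H))).trans_lt hF
    have e : conjOp R T S - R ∘L F ∘L T = R ∘L (S - F) ∘L T := by ext x; simp [conjOp]
    calc approxNumber (n + 1) (conjOp R T S) ≤ ‖conjOp R T S - R ∘L F ∘L T‖ := approxNumber_le hr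
      _ = ‖R ∘L (S - F) ∘L T‖ := by rw [e]
      _ ≤ ‖R‖ * (‖S - F‖ * ‖T‖) := (ContinuousLinearMap.opNorm_comp_le _ _).trans
          (by gcongr; exact ContinuousLinearMap.opNorm_comp_le _ _)
      _ ≤ ‖R‖ * ((approxNumber (n + 1) S + 1 / (k + 1)) * ‖T‖) := by gcongr
      _ = _ := by ring

theorem approxNumber_add_le (S T : H →L[ℂ] H) (k : ℕ) :
    approxNumber (2 * k + 1) (S + T) ≤ approxNumber (k + 1) S + approxNumber (k + 1) T := by
  refine le_of_forall_pos_le_add fun ε hε => ?_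
  obtain ⟨F, hF, h⟩ := exists_approx S (lt_add_of_pos_right (approxNumber (k + 1) S) (half_pos hε))
  obtain ⟨G, hG, h'⟩ := exists_approx T (lt_add_of_pos_right (approxNumber (k + 1) T) (half_pos hε))
  have hr : LinearMap.rank ((F + G : H →L[ℂ] H) : H →ₗ[ℂ] H) < ((2 * k + 1 : ℕ) : Cardinal) := by
    refine (LinearMap.rank_add_le (F : H →ₗ[ℂ] H) (G : H →ₗ[ℂ] H)).trans_lt ?_
    obtain ⟨a, ha⟩ := Cardinal.lt_aleph0.1 (hF.trans Cardinal.natCast_lt_aleph0)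
    obtain ⟨b, hb⟩ := Cardinal.lt_aleph0.1 (hG.trans Cardinal.natCast_lt_aleph0)
    rw [ha] at hF ⊢
    rw [hb] at hG ⊢
    norm_cast at hF hG ⊢
    omega
  have e : S + T - (F + G) = (S - F) + (T - G) := by abel
  have := approxNumber_le (T := S + T) hr
  rw [e] at this
  linarith [norm_add_le (S - F) (T - G)]

/-- `T` belongs to `S_p` if its approximation numbers `(a_n(T))_{n ≥ 1}` form a sequence in
`ℓ^p`. -/
def IsSchatten (p : ℝ) (T : H →L[ℂ] H) : Prop :=
  Summable fun n : ℕ => approxNumber (n + 1) T ^ p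

theorem IsSchatten.conjOp {p : ℝ} (hp : 1 ≤ p) (R T : H →L[ℂ] H) {S : H →L[ℂ] H}
    (hS : IsSchatten p S) : IsSchatten p (conjOp R T S) := by
  refine Summable.of_nonneg_of_le (fun n => Real.rpow_nonneg (approxNumber_nonneg _ _) _)
    (fun n => ?_) (Summable.mul_left ((‖R‖ * ‖T‖) ^ p) hS)
  rw [← Real.mul_rpow (by positivity) (approxNumber_nonneg _ _)]
  exact Real.rpow_le_rpow (approxNumber_nonneg _ _) (approxNumber_conjOp_le _ _ _ _) (by linarith)

theorem IsSchatten.zero {p : ℝ} (hp : 1 ≤ p) : IsSchatten p (0 : H →L[ℂ] H) := by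
  have h : ∀ n : ℕ, approxNumber (n + 1) (0 : H →L[ℂ] H) = 0 := fun n =>
    le_antisymm ((approxNumber_le (F := 0) (by simp)).trans (by simp)) (approxNumber_nonneg _ _)
  simp only [IsSchatten, h]
  rw [Real.zero_rpow (by linarith)]
  exact summable_zero

theorem IsSchatten.smul {p : ℝ} (hp : 1 ≤ p) (c : ℂ) {S : H →L[ℂ] H} (hS : IsSchatten p S) :
    IsSchatten p (c • S) := by
  have h := hS.conjOp hp (c • ContinuousLinearMap.id ℂ H) (ContinuousLinearMap.id ℂ H)
  have e : _root_.conjOp (c • ContinuousLinearMap.id ℂ H) (ContinuousLinearMap.id ℂ H) S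
      = c • S := by
    ext x; simp [_root_.conjOp]
  rwa [e] at h

theorem IsSchatten.add {p : ℝ} (hp : 1 ≤ p) {S T : H →L[ℂ] H} (hS : IsSchatten p S)
    (hT : IsSchatten p T) : IsSchatten p (S + T) := by
  have hp0 : 0 ≤ p := by linarith
  have key : ∀ k : ℕ, (approxNumber (k + 1) S + approxNumber (k + 1) T) ^ p
      ≤ 2 ^ p * (approxNumber (k + 1) S ^ p + approxNumber (k + 1) T ^ p) := fun k => by
    have hs := approxNumber_nonneg (k + 1) S
    have ht := approxNumber_nonneg (k + 1) T
    have hs' := Real.rpow_nonneg hs p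
    have ht' := Real.rpow_nonneg ht p
    rcases le_total (approxNumber (k + 1) S) (approxNumber (k + 1) T) with h | h
    · calc _ ≤ (2 * approxNumber (k + 1) T) ^ p := by gcongr; linarith
        _ = 2 ^ p * approxNumber (k + 1) T ^ p := Real.mul_rpow (by norm_num) ht
        _ ≤ _ := by gcongr; linarith
    · calc _ ≤ (2 * approxNumber (k + 1) S) ^ p := by gcongr; linarith
        _ = 2 ^ p * approxNumber (k + 1) S ^ p := Real.mul_rpow (by norm_num) hs
        _ ≤ _ := by gcongr; linarith
  have hsum : Summable fun k : ℕ =>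
      2 ^ p * (approxNumber (k + 1) S ^ p + approxNumber (k + 1) T ^ p) :=
    (Summable.add (f := fun k : ℕ => approxNumber (k + 1) S ^ p)
      (g := fun k : ℕ => approxNumber (k + 1) T ^ p) hS hT).mul_left _
  have heven : Summable fun k : ℕ => approxNumber (2 * k + 1) (S + T) ^ p :=
    Summable.of_nonneg_of_le (fun k => Real.rpow_nonneg (approxNumber_nonneg _ _) _)
      (fun k => (Real.rpow_le_rpow (approxNumber_nonneg _ _) (approxNumber_add_le S T k) hp0).trans
        (key k)) hsum
  have hodd : Summable fun k : ℕ => approxNumber (2 * k + 1 + 1) (S + T) ^ p :=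
    Summable.of_nonneg_of_le (fun k => Real.rpow_nonneg (approxNumber_nonneg _ _) _)
      (fun k => Real.rpow_le_rpow (approxNumber_nonneg _ _)
        (approxNumber_succ_le (2 * k) (S + T)) hp0) heven
  have h := HasSum.even_add_odd (f := fun n : ℕ => approxNumber (n + 1) (S + T) ^ p)
    heven.hasSum hodd.hasSum
  exact h.summable

variable (H) in
/-- The linear subspace `S_p(H)` of the bounded operators, `1 ≤ p < ∞`. -/
def schattenSubmodule (p : ℝ) (hp : 1 ≤ p) : Submodule ℂ (H →L[ℂ] H) where
  carrier := {T | IsSchatten p T}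
  zero_mem' := IsSchatten.zero hp
  add_mem' := IsSchatten.add hp
  smul_mem' c _ hT := IsSchatten.smul hp c hT

variable (H) in
/-- The space `S_p(H)`, `1 ≤ p < ∞`. This is a type synonym, so that it does not carry the
topology of the operator norm. -/
def SchattenClass (p : ℝ) (hp : 1 ≤ p) : Type _ := schattenSubmodule H p hp

instance (p : ℝ) (hp : 1 ≤ p) : AddCommGroup (SchattenClass H p hp) :=
  inferInstanceAs (AddCommGroup (schattenSubmodule H p hp))

instance (p : ℝ) (hp : 1 ≤ p) : Module ℂ (SchattenClass H p hp) :=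
  inferInstanceAs (Module ℂ (schattenSubmodule H p hp))

/-- The operator underlying an element of `S_p(H)`. -/
def SchattenClass.toCLM {p : ℝ} {hp : 1 ≤ p} (T : SchattenClass H p hp) : H →L[ℂ] H :=
  (show schattenSubmodule H p hp from T).1

/-- The Schatten norm `‖T‖_p = (∑_{n ≥ 1} a_n(T) ^ p) ^ (1 / p)`. -/
instance (p : ℝ) (hp : 1 ≤ p) : Norm (SchattenClass H p hp) where
  norm T := (∑' n : ℕ, approxNumber (n + 1) T.toCLM ^ p) ^ (1 / p)

/-- The topology of the norm `‖·‖_p`: a set is open if and only if it contains a ball of positive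
radius around each of its points. -/
instance (p : ℝ) (hp : 1 ≤ p) : TopologicalSpace (SchattenClass H p hp) where
  IsOpen U := ∀ T ∈ U, ∃ ε > (0 : ℝ), ∀ S : SchattenClass H p hp, ‖S - T‖ < ε → S ∈ U
  isOpen_univ _ _ := ⟨1, one_pos, fun _ _ => trivial⟩
  isOpen_inter U V hU hV T hT := by
    obtain ⟨ε, hε, h⟩ := hU T hT.1
    obtain ⟨δ, hδ, h'⟩ := hV T hT.2
    exact ⟨min ε δ, lt_min hε hδ, fun S hS =>
      ⟨h S (hS.trans_le (min_le_left _ _)), h' S (hS.trans_le (min_le_right _ _))⟩⟩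
  isOpen_sUnion s hs T := by
    rintro ⟨U, hU, hT⟩
    obtain ⟨ε, hε, h⟩ := hs U hU T hT
    exact ⟨ε, hε, fun S hS => ⟨U, hU, h S hS⟩⟩

/-- The map `S ↦ R S T` on `S_p(H)`. -/
def conjSchatten (p : ℝ) (hp : 1 ≤ p) (R T : H →L[ℂ] H) :
    SchattenClass H p hp →ₗ[ℂ] SchattenClass H p hp :=
  show schattenSubmodule H p hp →ₗ[ℂ] schattenSubmodule H p hp from
    (conjOp R T).restrict fun _ hS => IsSchatten.conjOp hp R T hS

end Operators

/-! ### Weighted Hardy spaces on the unit disc -/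

/-- A function on the open unit disc is analytic. -/
def IsAnalyticOnDisc (f : 𝔻 → ℂ) : Prop :=
  ∃ F : ℂ → ℂ, AnalyticOnNhd ℂ F (Metric.ball 0 1) ∧ ∀ z : 𝔻, f z = F z

/-- `H` is the space `H^β(𝔻)`: a Hilbert space of functions on the open unit disc with continuous
evaluations (this is the meaning of the class `RKHS ℂ H 𝔻 ℂ`), all of whose elements are analytic,
which has the functions `e_n(z) = β_n z ^ n`, `n ≥ 0`, as an orthonormal basis, where `β_n > 0`. -/
structure IsWeightedHardySpace (β : ℕ → ℝ) (H : Type*) [NormedAddCommGroup H]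
    [InnerProductSpace ℂ H] [CompleteSpace H] [RKHS ℂ H 𝔻 ℂ] : Prop where
  weight_pos : ∀ n, 0 < β n
  analytic : ∀ f : H, IsAnalyticOnDisc f
  exists_basis : ∃ e : HilbertBasis ℕ ℂ H, ∀ (n : ℕ) (z : 𝔻), e n z = (β n : ℂ) * (z : ℂ) ^ n

/-- The bounded operator `M` is the operator `f ↦ φ f` of multiplication by `φ`. -/
def IsMultiplicationOperator {H : Type*} [NormedAddCommGroup H] [InnerProductSpace ℂ H]
    [RKHS ℂ H 𝔻 ℂ] (φ : 𝔻 → ℂ) (M : H →L[ℂ] H) : Prop :=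
  ∀ (f : H) (z : 𝔻), M f z = φ z * f z

end

/-! ### Separated sets of positive lower density -/

/-! Write `u ⊗ v` for `rankOne ℂ u v`, which is conjugate-linear in `v`. The map `S ↦ R S T` sends
`u ⊗ v` to `R u ⊗ T* v`, and the reproducing kernel `k_z` is an eigenvector of `M_φ*` with
eigenvalue `conj (φ z)`. So `k_z ⊗ k_w` is an eigenvector with eigenvalue `conj (φ z) * ψ w`, which
is unimodular when `|φ z ψ w| = 1`. One symbol is non-constant, so one factor can be frozen while
the kernel in the other moves along a curve `E t` on which the total eigenvalue is `exp (-2πit)`.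

For a test function `f`, the vectors `∫ f t • exp (-2πint) • E t` form a two-sided orbit. They are
values at integers of the Fourier transform of a Schwartz function, hence absolutely summable. By
the identity theorem nothing nonzero is orthogonal to the curve, so such vectors are dense
(`dense_summableOrbitVectors_adjoint`), and the rank-one operators with a trace-norm summable
two-sided orbit approximate all rank-one operators.

A frequent hypercyclicity criterion then applies (`exists_frequently_approximating`). Given
operators `A k` with summable orbits `Y k`, put `x = ∑ Y k (-n)` over all `k` and `n ∈ E k`. At time
`n ∈ E k` the orbit of `x` is `A k` plus terms `Y l (n - m)` with `m ∈ E l`, which are small if the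
sets `E k` are far apart. Such sets of positive lower density come from `exists_separated_sets`.

All of this takes place in the trace norm, which is stronger than the three topologies, while
operators of finite rank are dense in all three spaces; one vector `x` therefore serves everywhere.
The trace norm enters only through the bound `TraceNormLE`, compared with approximation numbers in
`TraceNormLE.sum_approxNumber_le`. -/

/-- The set `A` has positive lower density, in the form of an eventual lower bound. -/
def HasPosLowerDensity (A : Set ℕ) : Prop :=
  ∃ δ : ℝ, 0 < δ ∧ ∀ᶠ M : ℕ in Filter.atTop, δ ≤ ((A ∩ Set.Icc 1 M).ncard : ℝ) / (M : ℝ)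

theorem HasPosLowerDensity.lowerDensity_pos {A B : Set ℕ} (hA : HasPosLowerDensity A)
    (hAB : A ⊆ B) : 0 < lowerDensity B := by
  obtain ⟨δ, hδ, h⟩ := hA
  refine hδ.trans_le (Filter.le_liminf_of_le ?_ ?_)
  -- A real `liminf` is a supremum that defaults to `0` when unbounded above; the ratios are at most
  -- `1`, so the default does not occur.
  · refine Filter.IsBoundedUnder.isCoboundedUnder_ge ⟨1, ?_⟩
    rw [Filter.eventually_map]
    refine Filter.Eventually.of_forall fun N => div_le_one_of_le₀ ?_ (by positivity)
    have := Set.ncard_le_ncard (s := B ∩ Set.Icc 1 N) Set.inter_subset_right (Set.finite_Icc 1 N)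
    rw [Set.ncard_eq_toFinset_card' (Set.Icc 1 N)] at this
    simp only [Set.toFinset_Icc, Nat.card_Icc, add_tsub_cancel_right] at this
    exact_mod_cast this
  · filter_upwards [h] with M hM
    refine hM.trans ?_
    gcongr
    exact (Set.finite_Icc 1 M).subset Set.inter_subset_right

/-- The position of the `j`-th block, when the blocks have half-widths `W 0, W 1, …`. -/
def blockCentre (W : ℕ → ℕ) (j : ℕ) : ℕ := 2 * ∑ i ∈ Finset.range j, W i + W j

theorem blockCentre_add_le (W : ℕ → ℕ) {i j : ℕ} (hij : i < j) :
    blockCentre W i + (W i + W j) ≤ blockCentre W j := by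
  have h : ∑ t ∈ Finset.range (i + 1), W t ≤ ∑ t ∈ Finset.range j, W t :=
    Finset.sum_le_sum_of_subset (Finset.range_mono hij)
  rw [Finset.sum_range_succ] at h
  unfold blockCentre
  omega

theorem blockCentre_le (W : ℕ → ℕ) (j : ℕ) :
    blockCentre W j ≤ 2 * ∑ i ∈ Finset.range (j + 1), W i := by
  rw [Finset.sum_range_succ, blockCentre]
  omega

theorem exists_strictMono_mul_le_two_pow (N : ℕ → ℕ) :
    ∃ a : ℕ → ℕ, StrictMono a ∧ ∀ k, N k * 2 ^ k ≤ 2 ^ a k := by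
  refine ⟨fun k => k + ∑ i ∈ Finset.range (k + 1), N i, ?_, fun k => ?_⟩
  · refine strictMono_nat_of_lt_succ fun k => ?_
    simp only [Finset.sum_range_succ _ (k + 1)]
    omega
  · simp only [pow_add]
    rw [mul_comm]
    gcongr
    calc N k ≤ 2 ^ N k := Nat.lt_two_pow_self.le
      _ ≤ _ := by
        gcongr
        · norm_num
        · exact Finset.single_le_sum (f := N) (fun _ _ => Nat.zero_le _)
            (Finset.self_mem_range_succ k)

/-- A lacunary choice of half-widths, attached to the `2`-adic valuation of the index. -/
def valuationWidth (N a : ℕ → ℕ) (j : ℕ) : ℕ :=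
  1 + ∑ k ∈ Finset.range (j + 1), if 2 ^ a k ∣ j + 1 then N k else 0

/-- At most `J / 2 ^ a k` of the first `J` indices carry the extra width `N k`, at a total cost of
at most `J / 2 ^ k`. The geometric series keeps the average width bounded, which is why the spacing
costs no density. -/
theorem sum_valuationWidth_le {N a : ℕ → ℕ} (ha : ∀ k, N k * 2 ^ k ≤ 2 ^ a k) (J : ℕ) :
    ∑ j ∈ Finset.range J, valuationWidth N a j ≤ 3 * J := by
  have hcount : ∀ k, (∑ j ∈ Finset.range J, if 2 ^ a k ∣ j + 1 then N k else 0)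
      = J / 2 ^ a k * N k := fun k => by
    rw [← Finset.sum_filter, Finset.sum_const, smul_eq_mul, Nat.card_multiples]
  have hk : ∀ k, ((J / 2 ^ a k * N k : ℕ) : ℝ) ≤ J * (1 / 2) ^ k := fun k => by
    have h1 : J / 2 ^ a k * N k * 2 ^ k ≤ J := by
      calc J / 2 ^ a k * N k * 2 ^ k = J / 2 ^ a k * (N k * 2 ^ k) := by ring
        _ ≤ J / 2 ^ a k * 2 ^ a k := by gcongr; exact ha k
        _ ≤ J := Nat.div_mul_le_self _ _
    have h2 : ((J / 2 ^ a k * N k : ℕ) : ℝ) * 2 ^ k ≤ J := by exact_mod_cast h1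
    rw [one_div, inv_pow, ← div_eq_mul_inv, le_div_iff₀ (by positivity)]
    exact h2
  have hsum : ∑ k ∈ Finset.range J, J / 2 ^ a k * N k ≤ 2 * J := by
    have : ((∑ k ∈ Finset.range J, J / 2 ^ a k * N k : ℕ) : ℝ) ≤ 2 * J := by
      rw [Nat.cast_sum]
      refine (Finset.sum_le_sum fun k _ => hk k).trans ?_
      rw [← Finset.mul_sum, mul_comm]
      gcongr
      exact sum_geometric_two_le J
    exact_mod_cast this
  calc ∑ j ∈ Finset.range J, valuationWidth N a j
      ≤ ∑ j ∈ Finset.range J, (1 + ∑ k ∈ Finset.range J, if 2 ^ a k ∣ j + 1 then N k else 0) := by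
        refine Finset.sum_le_sum fun j hj => ?_
        unfold valuationWidth
        gcongr
        exact Finset.mem_range.1 hj
    _ = J + ∑ k ∈ Finset.range J, J / 2 ^ a k * N k := by
        rw [Finset.sum_add_distrib, Finset.sum_comm]
        simp only [hcount]
        simp
    _ ≤ 3 * J := by omega

theorem le_valuationWidth {N a : ℕ → ℕ} (ha : StrictMono a) {j k : ℕ}
    (h : 2 ^ a k ∣ j + 1) : N k ≤ valuationWidth N a j := by
  -- The truncation of the sum in `valuationWidth` loses nothing, since `k ≤ a k < 2 ^ a k ≤ j + 1`.
  have hk : k < j + 1 := by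
    have h1 := Nat.le_of_dvd (Nat.succ_pos j) h
    have h2 : a k < 2 ^ a k := Nat.lt_two_pow_self
    have h3 := ha.id_le k
    simp only [id] at h3
    omega
  have := Finset.single_le_sum (s := Finset.range (j + 1))
    (f := fun k => if 2 ^ a k ∣ j + 1 then N k else 0) (fun _ _ => Nat.zero_le _)
    (Finset.mem_range.2 hk)
  simp only [h, if_true] at this
  unfold valuationWidth
  omega

/-- The integers are cut into consecutive blocks of half-width `W j` around `P j`, and `E k`
collects the centres whose index `j + 1` has 2-adic valuation `a k`. Distinct centres differ by at
least the sum of their half-widths, and `P` grows linearly because the average width is bounded. -/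
theorem exists_separated_sets (N : ℕ → ℕ) : ∃ E : ℕ → Set ℕ,
    (∀ k, HasPosLowerDensity (E k)) ∧ (∀ k, ∀ n ∈ E k, N k ≤ n) ∧
    ∀ k l n m, n ∈ E k → m ∈ E l → (k, n) ≠ (l, m) → N k + N l ≤ ((n : ℤ) - m).natAbs := by
  obtain ⟨a, hmono, ha⟩ := exists_strictMono_mul_le_two_pow N
  obtain ⟨W, hW1, hWN, hWsum⟩ : ∃ W : ℕ → ℕ, (∀ j, 1 ≤ W j) ∧
      (∀ j k, 2 ^ a k ∣ j + 1 → N k ≤ W j) ∧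
      ∀ J, ∑ j ∈ Finset.range J, W j ≤ 3 * J :=
    ⟨valuationWidth N a, fun _ => Nat.le_add_right _ _, fun _ _ => le_valuationWidth hmono,
      sum_valuationWidth_le ha⟩
  obtain ⟨P, hPW, hPadd, hPle⟩ : ∃ P : ℕ → ℕ, (∀ j, W j ≤ P j) ∧
      (∀ i j, i < j → P i + (W i + W j) ≤ P j) ∧ ∀ j, P j ≤ 6 * (j + 1) :=
    ⟨blockCentre W, fun _ => Nat.le_add_left _ _, fun _ _ => blockCentre_add_le W, fun j => by
      have h1 := blockCentre_le W j
      have h2 := hWsum (j + 1)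
      omega⟩
  have hPmono : StrictMono P := fun i j h => by
    have := hPadd i j h
    have := hW1 i
    omega
  -- the indices with `2`-adic valuation exactly `a k`
  set I : ℕ → Set ℕ := fun k => {j | ∃ q, j + 1 = 2 ^ a k * (2 * q + 1)} with hI
  have hdvd : ∀ {k j}, j ∈ I k → 2 ^ a k ∣ j + 1 := fun {k j} ⟨q, hq⟩ => ⟨_, hq⟩
  have hIinj : ∀ {k l j}, j ∈ I k → j ∈ I l → k = l := by
    intro k l j hk hl
    have key : ∀ {k l : ℕ}, j ∈ I k → j ∈ I l → ¬ k < l := by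
      rintro k l ⟨q, hq⟩ ⟨s, hs⟩ hkl
      have h1 : 2 ^ (a k + 1) ∣ j + 1 :=
        (pow_dvd_pow 2 (hmono hkl)).trans ⟨_, hs⟩
      rw [hq, pow_succ] at h1
      have h2 := Nat.dvd_of_mul_dvd_mul_left (by positivity) h1
      omega
    rcases lt_trichotomy k l with h | h | h
    · exact absurd h (key hk hl)
    · exact h
    · exact absurd h (key hl hk)
  refine ⟨fun k => P '' I k, fun k => ?_, ?_, ?_⟩
  -- The element of `E k` numbered `q` is at most `12 * 2 ^ a k * (q + 1)`; the further factor `2`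
  -- absorbs the rounding in `Q`.
  · refine ⟨1 / (24 * 2 ^ a k), by positivity, ?_⟩
    filter_upwards [Filter.eventually_ge_atTop (24 * 2 ^ a k)] with M hM
    set Q := M / (12 * 2 ^ a k) with hQ
    have hsub : (fun q => P (2 ^ a k * (2 * q + 1) - 1)) '' (Finset.range Q : Set ℕ)
        ⊆ P '' I k ∩ Set.Icc 1 M := by
      rintro _ ⟨q, hq, rfl⟩
      have hpos : 0 < 2 ^ a k * (2 * q + 1) := by positivity
      have hq' : q + 1 ≤ Q := by simpa using hq
      refine ⟨⟨_, ⟨q, by omega⟩, rfl⟩, ?_, ?_⟩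
      · exact (hW1 _).trans (hPW _)
      · refine (hPle _).trans ?_
        rw [Nat.sub_add_cancel hpos]
        calc 6 * (2 ^ a k * (2 * q + 1)) ≤ 6 * (2 ^ a k * (2 * (q + 1))) := by gcongr; omega
          _ = (q + 1) * (12 * 2 ^ a k) := by ring
          _ ≤ Q * (12 * 2 ^ a k) := by gcongr
          _ ≤ M := Nat.div_mul_le_self _ _
    have hinj : Function.Injective (fun q => P (2 ^ a k * (2 * q + 1) - 1)) := by
      intro q s h
      have h1 := hPmono.injective h
      have hq : 0 < 2 ^ a k * (2 * q + 1) := by positivity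
      have hs : 0 < 2 ^ a k * (2 * s + 1) := by positivity
      have h2 : 2 ^ a k * (2 * q + 1) = 2 ^ a k * (2 * s + 1) := by omega
      have := Nat.eq_of_mul_eq_mul_left (by positivity) h2
      omega
    have hcard : Q ≤ (P '' I k ∩ Set.Icc 1 M).ncard := by
      refine le_trans ?_ (Set.ncard_le_ncard hsub ((Set.finite_Icc 1 M).subset
        Set.inter_subset_right))
      rw [Set.ncard_image_of_injective _ hinj, Set.ncard_coe_finset, Finset.card_range]
    have hM0 : 0 < M := lt_of_lt_of_le (by positivity) hM
    have hQ2 : M ≤ Q * (24 * 2 ^ a k) := by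
      have h1 : M < 12 * 2 ^ a k * (Q + 1) := Nat.lt_mul_div_succ M (by positivity)
      have h2 : 2 ≤ Q := (Nat.le_div_iff_mul_le (by positivity)).2 (by linarith)
      nlinarith
    rw [div_le_div_iff₀ (by positivity) (by exact_mod_cast hM0), one_mul]
    have : M ≤ (P '' I k ∩ Set.Icc 1 M).ncard * (24 * 2 ^ a k) :=
      hQ2.trans (Nat.mul_le_mul_right _ hcard)
    exact_mod_cast this
  · rintro k _ ⟨j, hj, rfl⟩
    exact (hWN _ _ (hdvd hj)).trans (hPW j)
  · rintro k l _ _ ⟨i, hi, rfl⟩ ⟨j, hj, rfl⟩ hne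
    have h1 := hWN _ _ (hdvd hi)
    have h2 := hWN _ _ (hdvd hj)
    rcases lt_trichotomy i j with h | h | h
    · have := hPadd _ _ h
      omega
    · subst h
      exact absurd (by rw [hIinj hi hj]) hne
    · have := hPadd _ _ h
      omega

/-! ### Sums of translates along separated sets -/

theorem exists_tail_le {c : ℤ → ℝ} (hc : Summable c) {ε : ℝ} (hε : 0 < ε) :
    ∃ N : ℕ, ∀ F : Finset ℤ, (∀ n ∈ F, N ≤ n.natAbs) → ∑ n ∈ F, c n ≤ ε := by
  obtain ⟨s, hs⟩ := summable_iff_vanishing_norm.1 hc ε hε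
  refine ⟨s.sup Int.natAbs + 1, fun F hF => ?_⟩
  have hd : Disjoint F s := by
    refine Finset.disjoint_left.2 fun n hn hns => ?_
    have := Finset.le_sup (f := Int.natAbs) hns
    have := hF n hn
    omega
  exact (le_abs_self _).trans (hs F hd).le

/-- For summable two-sided sequences `c l` there are sets `E l` of positive lower density such that
the sums of the translates of `c l` along `E l` are small. -/
theorem exists_sets_sum_translates_le {c : ℕ → ℤ → ℝ}
    (hc : ∀ l, Summable (c l)) : ∃ E : ℕ → Set ℕ, (∀ k, HasPosLowerDensity (E k)) ∧
    (∀ F : Finset (ℕ × ℕ), (∀ p ∈ F, p.2 ∈ E p.1) → ∑ p ∈ F, c p.1 (-p.2) ≤ 2) ∧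
    ∀ k, ∀ n ∈ E k, ∀ F : Finset (ℕ × ℕ), (∀ p ∈ F, p.2 ∈ E p.1 ∧ p ≠ (k, n)) →
      ∑ p ∈ F, c p.1 (n - p.2) ≤ 2 * (1 / 2) ^ k := by
  -- `N k` controls the tails of all `c l` with `l ≤ k`. For a pair `k, l` the larger index gives
  -- the bound `4 ^ (-max k l) ≤ 2 ^ (-k) * 2 ^ (-l)`, summable over `l` with total proportional to
  -- `2 ^ (-k)`.
  have hN : ∀ k, ∃ N : ℕ, ∀ l ≤ k, ∀ F : Finset ℤ, (∀ n ∈ F, N ≤ n.natAbs) →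
      ∑ n ∈ F, c l n ≤ (1 / 2) ^ k * (1 / 2) ^ k := fun k => by
    choose M hM using fun l => exists_tail_le (hc l)
      (ε := (1 / 2) ^ k * (1 / 2) ^ k) (by positivity)
    refine ⟨(Finset.range (k + 1)).sup M, fun l hl F hF => hM l F fun n hn => ?_⟩
    exact (Finset.le_sup (Finset.mem_range.2 (Nat.lt_succ_of_le hl))).trans (hF n hn)
  choose N hN using hN
  obtain ⟨E, hE, hE1, hE2⟩ := exists_separated_sets N
  have hpow : ∀ {k l : ℕ}, k ≤ l → ((1 : ℝ) / 2) ^ l ≤ (1 / 2) ^ k := fun h =>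
    pow_le_pow_of_le_one (by norm_num) (by norm_num) h
  have htail : ∀ k l (F : Finset ℤ), (∀ n ∈ F, N k + N l ≤ n.natAbs) →
      ∑ n ∈ F, c l n ≤ (1 / 2) ^ k * (1 / 2) ^ l := fun k l F hF => by
    rcases le_total l k with h | h
    · refine (hN k l h F fun n hn => by have := hF n hn; omega).trans ?_
      gcongr ?_ * ?_
      exact hpow h
    · refine (hN l l le_rfl F fun n hn => by have := hF n hn; omega).trans ?_
      gcongr ?_ * ?_
      exact hpow h
  have hfib : ∀ (C : ℝ) (n : ℤ) (F : Finset (ℕ × ℕ)), 0 ≤ C →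
      (∀ l, ∀ G : Finset ℤ, (∀ j ∈ G, ∃ m : ℕ, (l, m) ∈ F ∧ n - m = j) →
        ∑ j ∈ G, c l j ≤ C * (1 / 2) ^ l) →
      ∑ p ∈ F, c p.1 (n - p.2) ≤ 2 * C := by
    intro C n F hC h
    set L := F.sup Prod.fst + 1 with hL
    have hmaps : ∀ p ∈ F, p.1 ∈ Finset.range L := fun p hp =>
      Finset.mem_range.2 (Nat.lt_succ_of_le (Finset.le_sup (f := Prod.fst) hp))
    rw [← Finset.sum_fiberwise_of_maps_to hmaps]
    calc _ ≤ ∑ l ∈ Finset.range L, C * (1 / 2) ^ l := by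
          refine Finset.sum_le_sum fun l _ => ?_
          have hinj : Set.InjOn (fun p : ℕ × ℕ => n - p.2) (F.filter fun p => p.1 = l) := by
            rintro ⟨p, q⟩ hp ⟨p', q'⟩ hp' h
            simp only [Finset.coe_filter, Set.mem_ofPred_eq] at hp hp' h
            ext
            · exact hp.2.trans hp'.2.symm
            · simp only; omega
          refine le_trans (le_of_eq ?_) (h l ((F.filter fun p => p.1 = l).image
            fun p => n - p.2) ?_)
          · rw [Finset.sum_image hinj]
            exact Finset.sum_congr rfl fun p hp => by rw [(Finset.mem_filter.1 hp).2]
          · intro j hj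
            obtain ⟨p, hp, rfl⟩ := Finset.mem_image.1 hj
            obtain ⟨hp1, rfl⟩ := Finset.mem_filter.1 hp
            exact ⟨p.2, hp1, rfl⟩
      _ = C * ∑ l ∈ Finset.range L, (1 / 2) ^ l := by rw [Finset.mul_sum]
      _ ≤ C * 2 := by gcongr; exact sum_geometric_two_le L
      _ = 2 * C := by ring
  refine ⟨E, hE, fun F hF => ?_, fun k n hn F hF => ?_⟩
  · have := hfib 1 0 F zero_le_one fun l G hG => ?_
    · simpa using this
    · refine (hN l l le_rfl G fun j hj => ?_).trans ?_
      · obtain ⟨m, hm, rfl⟩ := hG j hj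
        have := hE1 l m (hF _ hm)
        omega
      · gcongr
        exact pow_le_one₀ (by norm_num) (by norm_num)
  · refine hfib _ n F (by positivity) fun l G hG => htail k l G fun j hj => ?_
    obtain ⟨m, hm, rfl⟩ := hG j hj
    exact hE2 k l n m hn (hF _ hm).1 fun h => (hF _ hm).2 h.symm

/-! ### The trace norm by duality -/

section TraceNorm

open InnerProductSpace

variable {H : Type*} [NormedAddCommGroup H] [InnerProductSpace ℂ H]

/-- The trace norm of `S` is at most `r`, expressed by duality with orthonormal systems. -/
def TraceNormLE (S : H →L[ℂ] H) (r : ℝ) : Prop :=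
  ∀ (K : ℕ) (e f : Fin K → H), Orthonormal ℂ e → Orthonormal ℂ f →
    ∑ k, ‖inner ℂ (f k) (S (e k))‖ ≤ r

theorem TraceNormLE.nonneg {S : H →L[ℂ] H} {r : ℝ} (h : TraceNormLE S r) : 0 ≤ r := by
  simpa using h 0 Fin.elim0 Fin.elim0 ⟨fun i => i.elim0, fun i => i.elim0⟩
    ⟨fun i => i.elim0, fun i => i.elim0⟩

theorem TraceNormLE.mono {S : H →L[ℂ] H} {r s : ℝ} (h : TraceNormLE S r) (hrs : r ≤ s) :
    TraceNormLE S s :=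
  fun K e f he hf => (h K e f he hf).trans hrs

theorem TraceNormLE.zero {r : ℝ} (hr : 0 ≤ r) : TraceNormLE (0 : H →L[ℂ] H) r :=
  fun K e f _ _ => by simpa using hr

theorem TraceNormLE.add {S T : H →L[ℂ] H} {r s : ℝ} (hS : TraceNormLE S r)
    (hT : TraceNormLE T s) : TraceNormLE (S + T) (r + s) := fun K e f he hf => by
  refine le_trans ?_ (add_le_add (hS K e f he hf) (hT K e f he hf))
  rw [← Finset.sum_add_distrib]
  refine Finset.sum_le_sum fun k _ => ?_
  rw [add_apply, inner_add_right]
  exact norm_add_le _ _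

/-- Cauchy–Schwarz, followed by Bessel's inequality for each of the two systems. -/
theorem TraceNormLE.rankOne (u v : H) : TraceNormLE (rankOne ℂ u v) (‖u‖ * ‖v‖) :=
  fun K e f he hf => by
  have hb : ∀ {g : Fin K → H} (w : H), Orthonormal ℂ g →
      ∑ k, ‖inner ℂ (g k) w‖ ^ 2 ≤ ‖w‖ ^ 2 := fun w hg => hg.sum_inner_products_le w
  have hcs := Finset.sum_mul_sq_le_sq_mul_sq Finset.univ (fun k => ‖inner ℂ (e k) v‖)
    (fun k => ‖inner ℂ (f k) u‖)
  have hterm : ∀ k, ‖inner ℂ (f k) (InnerProductSpace.rankOne ℂ u v (e k))‖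
      = ‖inner ℂ (e k) v‖ * ‖inner ℂ (f k) u‖ := fun k => by
    rw [rankOne_apply, inner_smul_right, norm_mul, norm_inner_symm]
  simp only [hterm]
  refine abs_le_of_sq_le_sq' ?_ (by positivity) |>.2
  refine hcs.trans ?_
  rw [mul_comm ‖u‖, mul_pow]
  gcongr
  · exact hb v he
  · exact hb u hf

theorem TraceNormLE.sum {ι : Type*} {S : ι → H →L[ℂ] H} {r : ι → ℝ}
    (h : ∀ i, TraceNormLE (S i) (r i)) (F : Finset ι) :
    TraceNormLE (∑ i ∈ F, S i) (∑ i ∈ F, r i) := by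
  classical
  induction F using Finset.induction_on with
  | empty => simpa using TraceNormLE.zero le_rfl
  | insert a F ha ih =>
    rw [Finset.sum_insert ha, Finset.sum_insert ha]
    exact (h a).add ih

/-- Each test sum is continuous for the operator norm, so the bound survives limits taken there;
convergence in the trace norm itself is not needed. -/
theorem TraceNormLE.hasSum {ι : Type*} {S : ι → H →L[ℂ] H} {r : ι → ℝ} {T : H →L[ℂ] H} {c : ℝ}
    (h : ∀ i, TraceNormLE (S i) (r i)) (hT : HasSum S T) (hc : ∀ F : Finset ι, ∑ i ∈ F, r i ≤ c) :
    TraceNormLE T c := fun K e f he hf => by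
  have hcont : Continuous fun A : H →L[ℂ] H => ∑ k, ‖inner ℂ (f k) (A (e k))‖ := by fun_prop
  exact le_of_tendsto' ((hcont.tendsto T).comp hT) fun F =>
    (TraceNormLE.sum h F K e f he hf).trans (hc F)

/-! ### Approximation numbers bounded by orthonormal systems -/

theorem orthonormal_snoc {K : ℕ} {e : Fin K → H} (he : Orthonormal ℂ e) {x : H} (hx : ‖x‖ = 1)
    (h : ∀ k, inner ℂ (e k) x = 0) : Orthonormal ℂ (Fin.snoc e x : Fin (K + 1) → H) := by
  refine ⟨fun i => ?_, fun i j => ?_⟩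
  · refine Fin.lastCases ?_ (fun i => ?_) i
    · simpa using hx
    · simpa using he.1 i
  · refine Fin.lastCases ?_ (fun i => ?_) i <;> refine Fin.lastCases ?_ (fun j => ?_) j
    · simp
    · intro _
      simpa using inner_eq_zero_symm.1 (h j)
    · intro _
      simpa using h i
    · intro hij
      simpa using he.2 (fun h => hij (by rw [h]))

/-- The difference between `S` and its compression is `P_W S + (1 - P_W) S P_V`, of rank at most `2
* K`. Removing `K` dimensions on both sides is the reason why only odd-indexed approximation numbers
appear below. -/
theorem approxNumber_le_norm_compression (S : H →L[ℂ] H) {K : ℕ} (V W : Submodule ℂ H)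
    [FiniteDimensional ℂ V] [FiniteDimensional ℂ W] (hV : Module.finrank ℂ V ≤ K)
    (hW : Module.finrank ℂ W ≤ K) :
    approxNumber (2 * K + 1) S ≤
      ‖(1 - W.starProjection) ∘L S ∘L (1 - V.starProjection)‖ := by
  have hrank : ∀ (U : Submodule ℂ H) [FiniteDimensional ℂ U], Module.finrank ℂ U ≤ K →
      LinearMap.rank ((U.starProjection : H →L[ℂ] H) : H →ₗ[ℂ] H) ≤ K := fun U _ hU => by
    rw [LinearMap.rank, Submodule.range_starProjection, ← Module.finrank_eq_rank]
    exact_mod_cast hU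
  have h := approxNumber_le (n := 2 * K + 1) (T := S)
    (F := W.starProjection ∘L S + ((1 - W.starProjection) ∘L S) ∘L V.starProjection) ?_
  · convert h using 2
    ext x
    simp
    abel
  · refine (LinearMap.rank_add_le (W.starProjection ∘L S : H →L[ℂ] H).toLinearMap
      (((1 - W.starProjection) ∘L S) ∘L V.starProjection : H →L[ℂ] H).toLinearMap).trans_lt ?_
    have h1 := (LinearMap.rank_comp_le_left S.toLinearMap W.starProjection.toLinearMap).trans
      (hrank W hW)
    have h2 := (LinearMap.rank_comp_le_right V.starProjection.toLinearMap
      ((1 - W.starProjection) ∘L S : H →L[ℂ] H).toLinearMap).trans (hrank V hV)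
    refine (add_le_add h1 h2).trans_lt ?_
    norm_cast
    omega

/-- Greedy choice: compress `S` to the orthogonal complements of the systems found so far. The
compression has norm above `t K`, and an almost norming vector and its image, normalised, extend the
two systems. -/
theorem exists_orthonormal_lt_norm_inner (S : H →L[ℂ] H) (K : ℕ) (t : ℕ → ℝ) (ht0 : ∀ k, 0 ≤ t k)
    (ht : ∀ k < K, t k < approxNumber (2 * k + 1) S) :
    ∃ e f : Fin K → H, Orthonormal ℂ e ∧ Orthonormal ℂ f ∧
      ∀ k : Fin K, t k < ‖inner ℂ (f k) (S (e k))‖ := by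
  induction K with
  | zero => exact ⟨Fin.elim0, Fin.elim0, ⟨fun i => i.elim0, fun i => i.elim0⟩,
      ⟨fun i => i.elim0, fun i => i.elim0⟩, fun i => i.elim0⟩
  | succ K ih =>
    obtain ⟨e, f, he, hf, hlt⟩ := ih fun k hk => ht k (hk.trans (Nat.lt_succ_self K))
    set V := Submodule.span ℂ (Set.range e) with hV
    set W := Submodule.span ℂ (Set.range f) with hW
    have : FiniteDimensional ℂ V := FiniteDimensional.span_of_finite ℂ (Set.finite_range e)
    have : FiniteDimensional ℂ W := FiniteDimensional.span_of_finite ℂ (Set.finite_range f)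
    have hfr : ∀ g : Fin K → H, Module.finrank ℂ (Submodule.span ℂ (Set.range g)) ≤ K :=
      fun g => by simpa [Set.finrank] using finrank_range_le_card (R := ℂ) g
    have hn := (ht K (Nat.lt_succ_self K)).trans_le
      (approxNumber_le_norm_compression S V W (hfr e) (hfr f))
    obtain ⟨x, hx⟩ : ∃ x, t K * ‖x‖ <
        ‖((1 - W.starProjection) ∘L S ∘L (1 - V.starProjection)) x‖ := by
      by_contra! hcon
      exact absurd (ContinuousLinearMap.opNorm_le_bound _ (ht0 K) hcon) (not_le.2 hn)
    set x' := (1 - V.starProjection) x with hx'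
    set y := (1 - W.starProjection) (S x') with hy
    have hx : t K * ‖x‖ < ‖y‖ := hx
    have hxV : x' ∈ Vᗮ := Submodule.sub_starProjection_mem_orthogonal x
    have hyW : y ∈ Wᗮ := Submodule.sub_starProjection_mem_orthogonal (S x')
    have hx'x : ‖x'‖ ≤ ‖x‖ := by
      have h := Submodule.starProjection_orthogonal_val (K := V) x
      rw [hx', sub_apply, one_apply_eq_self, ← h]
      exact Submodule.norm_starProjection_apply_le _ x
    have hy0 : 0 < ‖y‖ := lt_of_le_of_lt (mul_nonneg (ht0 K) (norm_nonneg x)) hx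
    have hx0 : 0 < ‖x'‖ := by
      rw [norm_pos_iff]
      intro h
      rw [hy, h, map_zero, map_zero, norm_zero] at hy0
      exact lt_irrefl _ hy0
    have hunit : ∀ {z : H}, 0 < ‖z‖ → ‖((‖z‖⁻¹ : ℝ) : ℂ) • z‖ = 1 := fun hz => by
      rw [norm_smul, Complex.norm_real, norm_inv, norm_norm, inv_mul_cancel₀ hz.ne']
    -- `y` is the projection of `S x'` to `Wᗮ`, so the new matrix coefficient, once normalised, is
    -- `‖y‖ / ‖x'‖`.
    have hyS : inner ℂ y (S x') = ((‖y‖ ^ 2 : ℝ) : ℂ) := by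
      have h1 : S x' = y + W.starProjection (S x') := by simp [hy]
      conv_lhs => rw [h1]
      rw [inner_add_right, Submodule.inner_left_of_mem_orthogonal
        (Submodule.starProjection_apply_mem W _) hyW, add_zero, inner_self_eq_norm_sq_to_K]
      simp
    refine ⟨Fin.snoc e (((‖x'‖⁻¹ : ℝ) : ℂ) • x'), Fin.snoc f (((‖y‖⁻¹ : ℝ) : ℂ) • y),
      orthonormal_snoc he (hunit hx0) fun k => ?_, orthonormal_snoc hf (hunit hy0) fun k => ?_,
      fun k => ?_⟩
    · rw [inner_smul_right, Submodule.inner_right_of_mem_orthogonal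
        (Submodule.subset_span (Set.mem_range_self k)) hxV, mul_zero]
    · rw [inner_smul_right, Submodule.inner_right_of_mem_orthogonal
        (Submodule.subset_span (Set.mem_range_self k)) hyW, mul_zero]
    · refine Fin.lastCases ?_ (fun k => ?_) k
      · simp only [Fin.snoc_last, Fin.val_last]
        rw [map_smul, inner_smul_left, inner_smul_right, hyS, norm_mul, norm_mul,
          RCLike.norm_conj, Complex.norm_real, Complex.norm_real, Complex.norm_real, norm_inv,
          norm_inv, norm_norm, norm_norm, norm_pow, norm_norm]
        have h1 : ‖y‖⁻¹ * (‖x'‖⁻¹ * ‖y‖ ^ 2) = ‖y‖ / ‖x'‖ := by field_simp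
        rw [h1, lt_div_iff₀ hx0]
        exact (mul_le_mul_of_nonneg_left hx'x (ht0 K)).trans_lt hx
      · simpa using hlt k

theorem approxNumber_antitone {S : H →L[ℂ] H} : Antitone fun n : ℕ => approxNumber (n + 1) S :=
  antitone_nat_of_succ_le fun n => approxNumber_succ_le n S

theorem TraceNormLE.sum_approxNumber_odd_le {S : H →L[ℂ] H} {r : ℝ} (h : TraceNormLE S r)
    (K : ℕ) : ∑ k ∈ Finset.range K, approxNumber (2 * k + 1) S ≤ r := by
  induction K with
  | zero => simpa using h.nonneg
  | succ K ih =>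
    -- The greedy choice needs thresholds strictly below the approximation numbers. A vanishing last
    -- number is dropped; otherwise all are positive, and `θ` times them is admissible for `θ < 1`,
    -- after which `θ → 1`.
    rcases (approxNumber_nonneg (2 * K + 1) S).eq_or_lt with h0 | h0
    · rw [Finset.sum_range_succ, ← h0, add_zero]
      exact ih
    · have hpos : ∀ k < K + 1, 0 < approxNumber (2 * k + 1) S := fun k hk =>
        h0.trans_le (approxNumber_antitone (by omega : 2 * k ≤ 2 * K))
      have hθ : ∀ θ : ℝ, 0 < θ → θ < 1 →
          θ * ∑ k ∈ Finset.range (K + 1), approxNumber (2 * k + 1) S ≤ r := fun θ hθ0 hθ1 => by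
        obtain ⟨e, f, he, hf, hlt⟩ := exists_orthonormal_lt_norm_inner S (K + 1)
          (fun k => θ * approxNumber (2 * k + 1) S)
          (fun k => mul_nonneg hθ0.le (approxNumber_nonneg _ _))
          (fun k hk => mul_lt_of_lt_one_left (hpos k hk) hθ1)
        refine le_trans ?_ (h _ e f he hf)
        rw [Finset.mul_sum, Finset.sum_range]
        exact Finset.sum_le_sum fun k _ => (hlt k).le
      have hlim : Filter.Tendsto (fun θ : ℝ => θ *
          ∑ k ∈ Finset.range (K + 1), approxNumber (2 * k + 1) S) (nhdsWithin 1 (Set.Iio 1))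
          (nhds (1 * ∑ k ∈ Finset.range (K + 1), approxNumber (2 * k + 1) S)) :=
        (Filter.Tendsto.mono_left (by
          exact (continuous_id.mul continuous_const).tendsto 1) nhdsWithin_le_nhds)
      rw [one_mul] at hlim
      refine le_of_tendsto hlim ?_
      filter_upwards [self_mem_nhdsWithin,
        mem_nhdsWithin_of_mem_nhds (lt_mem_nhds (zero_lt_one' ℝ))] with θ h1 h2
      exact hθ θ h2 h1

theorem TraceNormLE.sum_approxNumber_le {S : H →L[ℂ] H} {r : ℝ} (h : TraceNormLE S r)
    (K : ℕ) : ∑ n ∈ Finset.range K, approxNumber (n + 1) S ≤ 2 * r := by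
  have h1 : ∀ K : ℕ, ∑ n ∈ Finset.range (2 * K), approxNumber (n + 1) S
      ≤ 2 * ∑ k ∈ Finset.range K, approxNumber (2 * k + 1) S := fun K => by
    induction K with
    | zero => simp
    | succ K ih =>
      rw [show 2 * (K + 1) = 2 * K + 1 + 1 by ring, Finset.sum_range_succ, Finset.sum_range_succ,
        Finset.sum_range_succ _ K]
      have := approxNumber_succ_le (2 * K) S
      linarith
  calc ∑ n ∈ Finset.range K, approxNumber (n + 1) S
      ≤ ∑ n ∈ Finset.range (2 * K), approxNumber (n + 1) S :=
        Finset.sum_le_sum_of_subset_of_nonneg (Finset.range_mono (by omega))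
          fun _ _ _ => approxNumber_nonneg _ _
    _ ≤ _ := (h1 K).trans (mul_le_mul_of_nonneg_left (h.sum_approxNumber_odd_le K) zero_le_two)

theorem approxNumber_one (S : H →L[ℂ] H) : approxNumber 1 S = ‖S‖ := by
  refine le_antisymm ((approxNumber_le (F := 0) (by simp)).trans (by simp)) ?_
  refine le_csInf ⟨_, 0, by simp, rfl⟩ ?_
  rintro _ ⟨F, hF, rfl⟩
  rw [Nat.cast_one, Cardinal.lt_one_iff] at hF
  have : F = 0 := by
    ext x
    have := LinearMap.range_eq_bot.1 (Submodule.rank_eq_zero.1 hF)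
    exact LinearMap.congr_fun this x
  simp [this]

theorem TraceNormLE.norm_le {S : H →L[ℂ] H} {r : ℝ} (h : TraceNormLE S r) : ‖S‖ ≤ r := by
  simpa [approxNumber_one] using h.sum_approxNumber_odd_le 1

theorem TraceNormLE.sum_approxNumber_rpow_le {S : H →L[ℂ] H} {r p : ℝ} (hp : 1 ≤ p)
    (h : TraceNormLE S r) (K : ℕ) :
    ∑ n ∈ Finset.range K, approxNumber (n + 1) S ^ p ≤ (2 * r) ^ p := by
  have hnn := approxNumber_nonneg (H := H)
  have hr := h.nonneg
  have hle : ∀ n, approxNumber (n + 1) S ≤ 2 * r := fun n =>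
    (approxNumber_antitone (Nat.zero_le n)).trans (by
      simp only [zero_add, approxNumber_one]
      linarith [h.norm_le])
  have hsplit : ∀ x : ℝ, 0 ≤ x → x ^ p = x ^ (p - 1) * x := fun x hx => by
    rcases hx.eq_or_lt with rfl | hx
    · rw [mul_zero, Real.zero_rpow (by linarith)]
    · rw [← Real.rpow_add_one hx.ne', sub_add_cancel]
  calc ∑ n ∈ Finset.range K, approxNumber (n + 1) S ^ p
      ≤ ∑ n ∈ Finset.range K, (2 * r) ^ (p - 1) * approxNumber (n + 1) S := by
        refine Finset.sum_le_sum fun n _ => ?_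
        rw [hsplit _ (hnn _ _)]
        exact mul_le_mul_of_nonneg_right (Real.rpow_le_rpow (hnn _ _) (hle n) (by linarith))
          (hnn _ _)
    _ ≤ (2 * r) ^ (p - 1) * (2 * r) := by
        rw [← Finset.mul_sum]
        exact mul_le_mul_of_nonneg_left (h.sum_approxNumber_le K) (by positivity)
    _ = (2 * r) ^ p := (hsplit _ (by positivity)).symm

theorem TraceNormLE.isSchatten {S : H →L[ℂ] H} {r p : ℝ} (hp : 1 ≤ p) (h : TraceNormLE S r) :
    IsSchatten p S :=
  summable_of_sum_range_le (fun _ => Real.rpow_nonneg (approxNumber_nonneg _ _) _)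
    fun K => h.sum_approxNumber_rpow_le hp K

theorem TraceNormLE.tsum_approxNumber_rpow_le {S : H →L[ℂ] H} {r p : ℝ} (hp : 1 ≤ p)
    (h : TraceNormLE S r) : ∑' n : ℕ, approxNumber (n + 1) S ^ p ≤ (2 * r) ^ p :=
  Real.tsum_le_of_sum_range_le (fun _ => Real.rpow_nonneg (approxNumber_nonneg _ _) _)
    fun K => h.sum_approxNumber_rpow_le hp K

end TraceNorm

/-! ### Sums of rank-one operators -/

section FiniteRank

variable {H : Type*} [NormedAddCommGroup H] [InnerProductSpace ℂ H]

variable (H) in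
/-- The operators which are finite sums of rank-one operators. -/
def rankOneSums : AddSubmonoid (H →L[ℂ] H) :=
  AddSubmonoid.closure {S | ∃ u v : H, S = InnerProductSpace.rankOne ℂ u v}

theorem rankOne_mem_rankOneSums (u v : H) :
    InnerProductSpace.rankOne ℂ u v ∈ rankOneSums H :=
  AddSubmonoid.subset_closure ⟨u, v, rfl⟩

theorem exists_traceNormLE_of_mem_rankOneSums {S : H →L[ℂ] H} (hS : S ∈ rankOneSums H) :
    ∃ r, TraceNormLE S r := by
  induction hS using AddSubmonoid.closure_induction with
  | mem S h => obtain ⟨u, v, rfl⟩ := h; exact ⟨_, TraceNormLE.rankOne u v⟩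
  | zero => exact ⟨0, TraceNormLE.zero le_rfl⟩
  | add S T _ _ hS hT =>
    obtain ⟨r, hr⟩ := hS
    obtain ⟨s, hs⟩ := hT
    exact ⟨_, hr.add hs⟩

theorem isCompactOperator_of_mem_rankOneSums {S : H →L[ℂ] H} (hS : S ∈ rankOneSums H) :
    IsCompactOperator S := by
  induction hS using AddSubmonoid.closure_induction with
  | mem S h =>
    obtain ⟨u, v, rfl⟩ := h
    have h1 : IsCompactOperator (innerSL ℂ v) :=
      isCompactOperator_of_locallyCompactSpace_dom (innerSL ℂ v)
    exact h1.clm_comp (ContinuousLinearMap.toSpanSingleton ℂ u)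
  | zero => exact isCompactOperator_zero
  | add S T _ _ hS hT => exact hS.add hT

theorem TotallyBounded.exists_norm_sub_starProjection_le {B : Set H} (hB : TotallyBounded B)
    {ε : ℝ} (hε : 0 < ε) : ∃ (V : Submodule ℂ H) (_ : FiniteDimensional ℂ V),
      ∀ y ∈ B, ‖y - V.starProjection y‖ ≤ ε := by
  obtain ⟨t, ht, hBt⟩ := Metric.totallyBounded_iff.1 hB ε hε
  have hfd : FiniteDimensional ℂ (Submodule.span ℂ t) := FiniteDimensional.span_of_finite ℂ ht
  refine ⟨Submodule.span ℂ t, hfd, fun y hy => ?_⟩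
  obtain ⟨x, hx, hyx⟩ := Set.mem_iUnion₂.1 (hBt hy)
  rw [Submodule.starProjection_minimal]
  refine (ciInf_le ⟨0, ?_⟩ (⟨x, Submodule.subset_span hx⟩ : Submodule.span ℂ t)).trans ?_
  · rintro _ ⟨z, rfl⟩
    exact norm_nonneg _
  · rw [Metric.mem_ball, dist_eq_norm] at hyx
    exact hyx.le

/-- If `G` approximates `T`, then `G - F` approximates `T - F` equally well, and its rank grows by
at most `N`. -/
theorem approxNumber_add_sub_le (T F : H →L[ℂ] H) {N : ℕ}
    (hF : LinearMap.rank (F : H →ₗ[ℂ] H) < ((N + 1 : ℕ) : Cardinal)) (n : ℕ) :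
    approxNumber (n + N + 1) (T - F) ≤ approxNumber (n + 1) T := by
  refine le_of_forall_gt_imp_ge_of_dense fun c hc => ?_
  obtain ⟨G, hG, h⟩ := exists_approx T hc
  have hr : LinearMap.rank ((G - F : H →L[ℂ] H) : H →ₗ[ℂ] H) < ((n + N + 1 : ℕ) : Cardinal) := by
    have h1 := LinearMap.rank_add_le (G : H →ₗ[ℂ] H) ((-1 : ℂ) • (F : H →ₗ[ℂ] H))
    have h2 : LinearMap.rank ((-1 : ℂ) • (F : H →ₗ[ℂ] H)) ≤ LinearMap.rank (F : H →ₗ[ℂ] H) := by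
      have := LinearMap.rank_comp_le_right (F : H →ₗ[ℂ] H)
        ((-1 : ℂ) • (LinearMap.id : H →ₗ[ℂ] H))
      exact this
    have h3 : ((G - F : H →L[ℂ] H) : H →ₗ[ℂ] H)
        = (G : H →ₗ[ℂ] H) + (-1 : ℂ) • (F : H →ₗ[ℂ] H) := by
      ext x; simp [sub_eq_add_neg]
    rw [h3]
    refine (h1.trans (add_le_add le_rfl h2)).trans_lt ?_
    obtain ⟨a, ha⟩ := Cardinal.lt_aleph0.1 (hF.trans Cardinal.natCast_lt_aleph0)
    obtain ⟨b, hb⟩ := Cardinal.lt_aleph0.1 (hG.trans Cardinal.natCast_lt_aleph0)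
    rw [ha] at hF ⊢
    rw [hb] at hG ⊢
    norm_cast at hF hG ⊢
    omega
  refine (approxNumber_le hr).trans ?_
  rw [sub_sub_sub_cancel_right]
  exact h.le

/-- A quasi-triangle inequality for the `p`-th powers. It follows from `approxNumber_add_le` at odd
indices, each even-indexed number being dominated by the preceding one, and it suffices for
comparing topologies. -/
theorem IsSchatten.tsum_add_le {p : ℝ} (hp : 1 ≤ p) {S T : H →L[ℂ] H} (hS : IsSchatten p S)
    (hT : IsSchatten p T) : ∑' n : ℕ, approxNumber (n + 1) (S + T) ^ p
      ≤ 2 * 2 ^ p * (∑' n : ℕ, approxNumber (n + 1) S ^ p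
        + ∑' n : ℕ, approxNumber (n + 1) T ^ p) := by
  have hp0 : 0 ≤ p := by linarith
  have hadd : Summable fun n : ℕ => approxNumber (n + 1) (S + T) ^ p := IsSchatten.add hp hS hT
  have key : ∀ k : ℕ, approxNumber (2 * k + 1) (S + T) ^ p
      ≤ 2 ^ p * (approxNumber (k + 1) S ^ p + approxNumber (k + 1) T ^ p) := fun k => by
    have hs := approxNumber_nonneg (k + 1) S
    have ht := approxNumber_nonneg (k + 1) T
    have hs' := Real.rpow_nonneg hs p
    have ht' := Real.rpow_nonneg ht p
    have hle := approxNumber_add_le S T k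
    calc approxNumber (2 * k + 1) (S + T) ^ p
        ≤ (2 * max (approxNumber (k + 1) S) (approxNumber (k + 1) T)) ^ p := by
          refine Real.rpow_le_rpow (approxNumber_nonneg _ _) (hle.trans ?_) hp0
          rw [two_mul]
          exact add_le_add (le_max_left _ _) (le_max_right _ _)
      _ = 2 ^ p * max (approxNumber (k + 1) S) (approxNumber (k + 1) T) ^ p :=
          Real.mul_rpow zero_le_two (le_max_of_le_left hs)
      _ ≤ _ := by
          gcongr
          rcases max_choice (approxNumber (k + 1) S) (approxNumber (k + 1) T) with h | h <;>
            rw [h] <;> linarith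
  have hsum := (Summable.add (f := fun k : ℕ => approxNumber (k + 1) S ^ p)
      (g := fun k : ℕ => approxNumber (k + 1) T ^ p) hS hT).mul_left (2 ^ p)
  have heven : Summable fun k : ℕ => approxNumber (2 * k + 1) (S + T) ^ p :=
    Summable.of_nonneg_of_le (fun k => Real.rpow_nonneg (approxNumber_nonneg _ _) _) key hsum
  have hoddle : ∀ k : ℕ, approxNumber (2 * k + 1 + 1) (S + T) ^ p
      ≤ approxNumber (2 * k + 1) (S + T) ^ p := fun k =>
    Real.rpow_le_rpow (approxNumber_nonneg _ _) (approxNumber_succ_le (2 * k) (S + T)) hp0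
  have hodd : Summable fun k : ℕ => approxNumber (2 * k + 1 + 1) (S + T) ^ p :=
    Summable.of_nonneg_of_le (fun k => Real.rpow_nonneg (approxNumber_nonneg _ _) _) hoddle heven
  have h := (HasSum.even_add_odd (f := fun n : ℕ => approxNumber (n + 1) (S + T) ^ p)
    heven.hasSum hodd.hasSum).tsum_eq
  rw [h]
  have h1 := Summable.tsum_le_tsum hoddle hodd heven
  have h2 := Summable.tsum_le_tsum key heven hsum
  rw [tsum_mul_left, Summable.tsum_add hS hT] at h2
  linarith

variable [CompleteSpace H]

theorem starProjection_comp_mem_rankOneSums (V : Submodule ℂ H) [FiniteDimensional ℂ V]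
    (S : H →L[ℂ] H) : V.starProjection ∘L S ∈ rankOneSums H := by
  rw [(stdOrthonormalBasis ℂ V).starProjection_eq_sum_rankOne, ContinuousLinearMap.finsetSum_comp]
  refine AddSubmonoid.sum_mem _ fun i _ => ?_
  rw [InnerProductSpace.rankOne_comp]
  exact rankOne_mem_rankOneSums _ _

theorem mem_rankOneSums_of_rank_lt {F : H →L[ℂ] H} {n : ℕ}
    (hF : LinearMap.rank (F : H →ₗ[ℂ] H) < (n : Cardinal)) : F ∈ rankOneSums H := by
  have : FiniteDimensional ℂ (LinearMap.range F.toLinearMap) :=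
    Module.rank_lt_aleph0_iff.1 (hF.trans Cardinal.natCast_lt_aleph0)
  have h := starProjection_comp_mem_rankOneSums (LinearMap.range F.toLinearMap) F
  convert h
  ext x
  exact (Submodule.starProjection_eq_self_iff.2 (LinearMap.mem_range_self F.toLinearMap x)).symm

theorem TotallyBounded.exists_rankOneSums_norm_sub_le {ι : Type*} (g : ι → H) (T : H →L[ℂ] H)
    (hB : TotallyBounded (Set.range fun i => T (g i))) {ε : ℝ} (hε : 0 < ε) :
    ∃ S ∈ rankOneSums H, ∀ i, ‖T (g i) - S (g i)‖ ≤ ε := by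
  obtain ⟨V, hV, h⟩ := hB.exists_norm_sub_starProjection_le hε
  exact ⟨_, starProjection_comp_mem_rankOneSums V T, fun i => h _ ⟨i, rfl⟩⟩

theorem IsCompactOperator.exists_rankOneSums_norm_sub_le {T : H →L[ℂ] H}
    (hT : IsCompactOperator T) {ε : ℝ} (hε : 0 < ε) :
    ∃ S ∈ rankOneSums H, ‖T - S‖ ≤ ε := by
  have hc := IsCompactOperator.isCompact_closure_image_closedBall (f := T.toLinearMap) hT 1
  have htb : TotallyBounded (Set.range fun x : Metric.closedBall (0 : H) 1 => T x) := by
    refine (hc.totallyBounded.subset subset_closure).subset ?_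
    rintro _ ⟨x, rfl⟩
    exact ⟨x, x.2, rfl⟩
  obtain ⟨S, hS, h⟩ := TotallyBounded.exists_rankOneSums_norm_sub_le _ T htb hε
  refine ⟨S, hS, ContinuousLinearMap.opNorm_le_of_unit_norm hε.le fun x hx => ?_⟩
  exact h ⟨x, by simp [hx]⟩

/-! ### Density of the finite rank operators in the Schatten classes -/

/-- Take `F` of rank at most `2 * M` nearly attaining `a_{2M+1}(T)`. The first `4 * M` numbers of `T
- F` contribute about `4 * M * a_{2M+1}(T) ^ p`, which the terms of `T` between `M` and `2 * M`
control; the later ones are bounded by a tail of the sum for `T`. -/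
theorem IsSchatten.exists_rankOneSums {p : ℝ} (hp : 1 ≤ p) {T : H →L[ℂ] H} (hT : IsSchatten p T)
    {η : ℝ} (hη : 0 < η) : ∃ S ∈ rankOneSums H, IsSchatten p (T - S) ∧
      ∑' n : ℕ, approxNumber (n + 1) (T - S) ^ p ≤ η := by
  have hp0 : 0 ≤ p := by linarith
  have hnn : ∀ (A : H →L[ℂ] H) n, 0 ≤ approxNumber n A ^ p := fun A n =>
    Real.rpow_nonneg (approxNumber_nonneg n A) p
  have hT' : Summable fun n : ℕ => approxNumber (n + 1) T ^ p := hT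
  obtain ⟨M, hM⟩ : ∃ M : ℕ, ∑' n : ℕ, approxNumber (n + M + 1) T ^ p < η / 16 :=
    ((tendsto_sum_nat_add fun n : ℕ => approxNumber (n + 1) T ^ p).eventually
      (gt_mem_nhds (by positivity : 0 < η / 16))).exists
  have htail : ∀ k, Summable fun n : ℕ => approxNumber (n + k + 1) T ^ p := fun k =>
    (summable_nat_add_iff (f := fun n : ℕ => approxNumber (n + 1) T ^ p) k).2 hT'
  have hanti : ∀ {m n : ℕ}, m ≤ n → approxNumber (n + 1) T ^ p ≤ approxNumber (m + 1) T ^ p :=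
    fun h => Real.rpow_le_rpow (approxNumber_nonneg _ _) (approxNumber_antitone h) hp0
  have hMa : M * approxNumber (2 * M + 1) T ^ p ≤ η / 16 := by
    refine le_trans ?_ hM.le
    refine le_trans ?_ ((htail M).sum_le_tsum (Finset.range M) fun n _ => hnn _ _)
    calc (M : ℝ) * approxNumber (2 * M + 1) T ^ p
        = ∑ n ∈ Finset.range M, approxNumber (2 * M + 1) T ^ p := by simp
      _ ≤ _ := Finset.sum_le_sum fun n hn => hanti (by have := Finset.mem_range.1 hn; omega)
  obtain ⟨c, hca, hc⟩ : ∃ c, approxNumber (2 * M + 1) T < c ∧ 4 * M * c ^ p < η / 2 := by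
    have hcont : Continuous fun c : ℝ => 4 * (M : ℝ) * c ^ p :=
      continuous_const.mul (Real.continuous_rpow_const hp0)
    have h1 := (hcont.tendsto (approxNumber (2 * M + 1) T)).eventually
      (gt_mem_nhds (by linarith : 4 * (M : ℝ) * approxNumber (2 * M + 1) T ^ p < η / 2))
    exact ((eventually_mem_nhdsWithin (s := Set.Ioi (approxNumber (2 * M + 1) T))).and
      (mem_nhdsWithin_of_mem_nhds h1)).exists
  obtain ⟨F, hF, hFc⟩ := exists_approx T hca
  have hFD := mem_rankOneSums_of_rank_lt hF
  have hsum : IsSchatten p (T - F) := by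
    obtain ⟨r, hr⟩ := exists_traceNormLE_of_mem_rankOneSums hFD
    have := IsSchatten.add hp hT (IsSchatten.smul hp (-1) (hr.isSchatten hp))
    simpa [sub_eq_add_neg] using this
  refine ⟨F, hFD, hsum, ?_⟩
  have hsum' : Summable fun n : ℕ => approxNumber (n + 1) (T - F) ^ p := hsum
  rw [← hsum'.sum_add_tsum_nat_add (4 * M)]
  have h1 : ∑ n ∈ Finset.range (4 * M), approxNumber (n + 1) (T - F) ^ p ≤ 4 * M * c ^ p := by
    calc _ ≤ ∑ n ∈ Finset.range (4 * M), c ^ p := by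
          refine Finset.sum_le_sum fun n _ => Real.rpow_le_rpow (approxNumber_nonneg _ _) ?_ hp0
          refine (approxNumber_antitone (Nat.zero_le n)).trans ?_
          simp only [zero_add, approxNumber_one]
          exact hFc.le
      _ = _ := by simp
  have h2 : ∑' n : ℕ, approxNumber (n + 4 * M + 1) (T - F) ^ p
      ≤ ∑' n : ℕ, approxNumber (n + M + 1) T ^ p := by
    refine Summable.tsum_le_tsum (fun n => ?_)
      ((summable_nat_add_iff (f := fun n : ℕ => approxNumber (n + 1) (T - F) ^ p) (4 * M)).2 hsum')
      (htail M)
    refine Real.rpow_le_rpow (approxNumber_nonneg _ _) ?_ hp0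
    have h3 := approxNumber_add_sub_le T F hF (n + 2 * M)
    rw [show n + 2 * M + 2 * M + 1 = n + 4 * M + 1 by ring] at h3
    exact h3.trans (approxNumber_antitone (by omega))
  linarith

theorem TraceNormLE.isCompactOperator {S : H →L[ℂ] H} {r : ℝ} (h : TraceNormLE S r) :
    IsCompactOperator S := by
  have hcl := isClosed_setOfPred_isCompactOperator (σ₁₂ := RingHom.id ℂ) (M₁ := H) (M₂ := H)
  refine hcl.closure_subset_iff.2 (subset_refl _) (Metric.mem_closure_iff.2 fun ε hε => ?_)
  obtain ⟨F, hF, hs, hle⟩ := (h.isSchatten le_rfl).exists_rankOneSums le_rfl (half_pos hε)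
  refine ⟨F, isCompactOperator_of_mem_rankOneSums hF, ?_⟩
  have h1 := hs.sum_le_tsum {0} fun n _ => Real.rpow_nonneg (approxNumber_nonneg _ _) _
  simp only [Finset.sum_singleton, zero_add, approxNumber_one, Real.rpow_one] at h1
  simp only [Real.rpow_one] at hle
  rw [dist_eq_norm]
  linarith

end FiniteRank

/-! ### A frequent hypercyclicity criterion in the trace norm -/

section Criterion

variable {H : Type*} [NormedAddCommGroup H] [InnerProductSpace ℂ H]

/-- `S` lies on a two-sided orbit of `conjOp R T` which is absolutely summable in the trace
norm. -/
def HasSummableOrbit (R T S : H →L[ℂ] H) : Prop :=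
  ∃ (Y : ℤ → H →L[ℂ] H) (c : ℤ → ℝ), Y 0 = S ∧ (∀ n, conjOp R T (Y n) = Y (n + 1)) ∧
    Summable c ∧ ∀ n, TraceNormLE (Y n) (c n)

/-- Every trace norm neighbourhood of `S` contains an operator satisfying `P`. -/
def IsTraceNormApproximable (P : (H →L[ℂ] H) → Prop) (S : H →L[ℂ] H) : Prop :=
  ∀ ε : ℝ, 0 < ε → ∃ A, P A ∧ TraceNormLE (A - S) ε

theorem HasSummableOrbit.zero (R T : H →L[ℂ] H) : HasSummableOrbit R T 0 :=
  ⟨fun _ => 0, fun _ => 0, rfl, fun _ => map_zero _, summable_zero,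
    fun _ => TraceNormLE.zero le_rfl⟩

theorem HasSummableOrbit.add {R T A B : H →L[ℂ] H} (hA : HasSummableOrbit R T A)
    (hB : HasSummableOrbit R T B) : HasSummableOrbit R T (A + B) := by
  obtain ⟨Y, c, hY0, hY, hc, hYc⟩ := hA
  obtain ⟨Z, d, hZ0, hZ, hd, hZd⟩ := hB
  exact ⟨fun n => Y n + Z n, fun n => c n + d n, by simp only [hY0, hZ0],
    fun n => by rw [map_add, hY, hZ], hc.add hd, fun n => (hYc n).add (hZd n)⟩

theorem IsTraceNormApproximable.zero {P : (H →L[ℂ] H) → Prop} (h : P 0) :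
    IsTraceNormApproximable P 0 :=
  fun ε hε => ⟨0, h, by simpa using TraceNormLE.zero hε.le⟩

theorem IsTraceNormApproximable.add {P : (H →L[ℂ] H) → Prop} (hP : ∀ A B, P A → P B → P (A + B))
    {S T : H →L[ℂ] H} (hS : IsTraceNormApproximable P S) (hT : IsTraceNormApproximable P T) :
    IsTraceNormApproximable P (S + T) := fun ε hε => by
  obtain ⟨A, hA, hAS⟩ := hS _ (half_pos hε)
  obtain ⟨B, hB, hBT⟩ := hT _ (half_pos hε)
  refine ⟨A + B, hP A B hA hB, ?_⟩
  have := hAS.add hBT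
  rwa [add_halves, ← add_sub_add_comm] at this

theorem IsTraceNormApproximable.trans {P Q : (H →L[ℂ] H) → Prop} {S : H →L[ℂ] H}
    (hS : IsTraceNormApproximable P S) (hPQ : ∀ A, P A → IsTraceNormApproximable Q A) :
    IsTraceNormApproximable Q S := fun ε hε => by
  obtain ⟨A, hA, hAS⟩ := hS _ (half_pos hε)
  obtain ⟨B, hB, hBA⟩ := hPQ A hA _ (half_pos hε)
  refine ⟨B, hB, ?_⟩
  have := hBA.add hAS
  rwa [add_halves, sub_add_sub_cancel] at this

theorem IsTraceNormApproximable.of_mem_rankOneSums {P : (H →L[ℂ] H) → Prop} (h0 : P 0)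
    (hadd : ∀ A B, P A → P B → P (A + B))
    (h : ∀ u v : H, IsTraceNormApproximable P (InnerProductSpace.rankOne ℂ u v))
    {S : H →L[ℂ] H} (hS : S ∈ rankOneSums H) : IsTraceNormApproximable P S := by
  induction hS using AddSubmonoid.closure_induction with
  | mem S h' => obtain ⟨u, v, rfl⟩ := h'; exact h u v
  | zero => exact IsTraceNormApproximable.zero h0
  | add S T _ _ hS hT => exact hS.add hadd hT

theorem traceNormLE_rankOne_sub (u v u' v' : H) :
    TraceNormLE (InnerProductSpace.rankOne ℂ u' v' - InnerProductSpace.rankOne ℂ u v)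
      (‖u' - u‖ * ‖v'‖ + ‖u‖ * ‖v' - v‖) := by
  have := (TraceNormLE.rankOne (u' - u) v').add (TraceNormLE.rankOne u (v' - v))
  convert this using 1
  rw [map_sub, map_sub, sub_apply]
  abel

theorem isTraceNormApproximable_rankOne {P : (H →L[ℂ] H) → Prop} {D : Set (H × H)}
    (hD : Dense D) (h : ∀ q ∈ D, P (InnerProductSpace.rankOne ℂ q.1 q.2)) (u v : H) :
    IsTraceNormApproximable P (InnerProductSpace.rankOne ℂ u v) := fun ε hε => by
  have hcont : Continuous fun q : H × H => ‖q.1 - u‖ * ‖q.2‖ + ‖u‖ * ‖q.2 - v‖ := by fun_prop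
  obtain ⟨q, hq, hqD⟩ := hD.inter_open_nonempty _ (isOpen_Iio.preimage hcont : IsOpen
    ((fun q : H × H => ‖q.1 - u‖ * ‖q.2‖ + ‖u‖ * ‖q.2 - v‖) ⁻¹' Set.Iio ε)) ⟨(u, v), by simpa⟩
  exact ⟨_, h q hqD, (traceNormLE_rankOne_sub u v q.1 q.2).mono (le_of_lt hq)⟩

/-- The sum of the rank-one operators on the vectors `h i` with indices from a list. -/
noncomputable def listRankOne (h : ℕ → H) (L : List (ℕ × ℕ)) : H →L[ℂ] H :=
  (L.map fun q => InnerProductSpace.rankOne ℂ (h q.1) (h q.2)).sum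

theorem listRankOne_mem_rankOneSums (h : ℕ → H) (L : List (ℕ × ℕ)) :
    listRankOne h L ∈ rankOneSums H := by
  refine AddSubmonoid.list_sum_mem _ fun S hS => ?_
  obtain ⟨q, -, rfl⟩ := List.mem_map.1 hS
  exact rankOne_mem_rankOneSums _ _

theorem isTraceNormApproximable_listRankOne {h : ℕ → H} (hh : DenseRange h) {S : H →L[ℂ] H}
    (hS : S ∈ rankOneSums H) : IsTraceNormApproximable (fun A => ∃ L, A = listRankOne h L) S := by
  refine IsTraceNormApproximable.of_mem_rankOneSums ⟨[], by simp [listRankOne]⟩ ?_ ?_ hS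
  · rintro _ _ ⟨L, rfl⟩ ⟨L', rfl⟩
    exact ⟨L ++ L', by simp [listRankOne]⟩
  · refine isTraceNormApproximable_rankOne (hh.prodMap hh) ?_
    rintro _ ⟨⟨a, b⟩, rfl⟩
    exact ⟨[(a, b)], by simp [listRankOne]⟩

theorem continuous_conjOp_pow (R T : H →L[ℂ] H) (n : ℕ) : Continuous ⇑(conjOp R T ^ n) := by
  rw [Module.End.coe_pow]
  refine Continuous.iterate ?_ n
  change Continuous fun S : H →L[ℂ] H => R ∘L S ∘L T
  fun_prop

theorem conjOp_pow_apply_orbit {R T : H →L[ℂ] H} {Y : ℤ → H →L[ℂ] H}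
    (hY : ∀ n, conjOp R T (Y n) = Y (n + 1)) (n : ℕ) (j : ℤ) :
    (conjOp R T ^ n) (Y j) = Y (n + j) := by
  induction n with
  | zero => simp
  | succ n ih =>
    rw [pow_succ', Module.End.mul_apply, ih, hY]
    congr 1
    push_cast
    ring

/-- If the operators with summable two-sided orbits approximate all rank-one operators, there is an
operator of finite trace norm whose orbit frequently approximates all finite rank operators. -/
theorem exists_frequently_approximating [CompleteSpace H] [TopologicalSpace.SeparableSpace H]
    {R T : H →L[ℂ] H} (hRT : ∀ u v : H,
      IsTraceNormApproximable (HasSummableOrbit R T) (InnerProductSpace.rankOne ℂ u v)) :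
    ∃ (x : H →L[ℂ] H) (r : ℝ), TraceNormLE x r ∧ ∀ S ∈ rankOneSums H, ∀ ε : ℝ, 0 < ε →
      ∃ E : Set ℕ, HasPosLowerDensity E ∧
        ∀ n ∈ E, TraceNormLE ((conjOp R T ^ n) x - S) ε := by
  set h := TopologicalSpace.denseSeq H with hh
  have hdense : DenseRange h := TopologicalSpace.denseRange_denseSeq H
  -- The index `k` encodes a pair `(L, m)`: a finite rank target from a countable dense family, and
  -- the precision `1 / (m + 1)`.
  have happ : ∀ k : ℕ, ∃ A, HasSummableOrbit R T A ∧
      TraceNormLE (A - listRankOne h (Denumerable.ofNat (List (ℕ × ℕ) × ℕ) k).1)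
        (1 / (((Denumerable.ofNat (List (ℕ × ℕ) × ℕ) k).2 : ℝ) + 1)) := fun k =>
    IsTraceNormApproximable.of_mem_rankOneSums (HasSummableOrbit.zero R T)
      (fun _ _ => HasSummableOrbit.add) hRT (listRankOne_mem_rankOneSums h _) _ (by positivity)
  choose A hA hAL using happ
  choose Y c hY0 hY hc hYc using hA
  obtain ⟨E, hE, hE1, hE2⟩ := exists_sets_sum_translates_le hc
  have hfin : ∀ (C : ℝ) (n : ℤ) (P : ℕ × ℕ → Prop), (∀ F : Finset (ℕ × ℕ), (∀ p ∈ F, P p) →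
      ∑ p ∈ F, c p.1 (n - p.2) ≤ C) → ∀ F : Finset {p : ℕ × ℕ // P p},
      ∑ p ∈ F, c p.1.1 (n - p.1.2) ≤ C := fun C n P hP F => by
    have := hP (F.map (Function.Embedding.subtype P)) fun p hp => by
      obtain ⟨q, -, rfl⟩ := Finset.mem_map.1 hp
      exact q.2
    rwa [Finset.sum_map] at this
  have hx1 := hfin 2 0 (fun p => p.2 ∈ E p.1) (by simpa using hE1)
  simp only [zero_sub] at hx1
  have hsummable : Summable fun p : {p : ℕ × ℕ // p.2 ∈ E p.1} => Y p.1.1 (-p.1.2) := by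
    refine Summable.of_norm_bounded (g := fun p : {p : ℕ × ℕ // p.2 ∈ E p.1} => c p.1.1 (-p.1.2))
      (summable_of_sum_le (fun p => (hYc _ _).nonneg) hx1) fun p => (hYc _ _).norm_le
  -- `x` is the sum of all `Y k (-n)` with `n ∈ E k`: at time `n` the corresponding term has become
  -- `Y k 0 = A k`.
  obtain ⟨x, hx⟩ := hsummable
  refine ⟨x, 2, TraceNormLE.hasSum (fun p => hYc _ _) hx hx1, fun S hS ε hε => ?_⟩
  obtain ⟨_, ⟨L, rfl⟩, hL⟩ := isTraceNormApproximable_listRankOne hdense hS (ε / 3) (by positivity)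
  obtain ⟨m, hm1, hm2⟩ : ∃ m : ℕ, 1 / ((m : ℝ) + 1) < ε / 3 ∧ 2 * (1 / 2 : ℝ) ^ m < ε / 3 := by
    have h1 := (tendsto_one_div_add_atTop_nhds_zero_nat (𝕜 := ℝ)).eventually
      (gt_mem_nhds (by positivity : 0 < ε / 3))
    have h2 : Filter.Tendsto (fun m : ℕ => 2 * (1 / 2 : ℝ) ^ m) Filter.atTop (nhds (2 * 0)) :=
      (tendsto_pow_atTop_nhds_zero_of_lt_one (by norm_num) (by norm_num)).const_mul 2
    rw [mul_zero] at h2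
    exact (h1.and (h2.eventually (gt_mem_nhds (by positivity : 0 < ε / 3)))).exists
  set k := Encodable.encode (L, m) with hk
  -- The pairing function dominates its second entry, so a large `m` makes both the precision and
  -- the interference bound `2 * 2 ^ (-k)` small.
  have hmk : m ≤ k := by
    rw [hk, Encodable.encode_prod_val]
    exact Nat.right_le_pair _ _
  have hAk := hAL k
  rw [hk, Denumerable.ofNat_encode] at hAk
  rw [← hk] at hAk
  refine ⟨E k, hE k, fun n hn => ?_⟩
  have hsum : HasSum (fun p : {p : ℕ × ℕ // p.2 ∈ E p.1} => Y p.1.1 (n - p.1.2))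
      ((conjOp R T ^ n) x) := by
    have := hx.map (conjOp R T ^ n) (continuous_conjOp_pow R T n)
    convert! this using 2 with p
    rw [Function.comp_apply, conjOp_pow_apply_orbit (hY _), sub_eq_add_neg]
  have hsub := hasSum_ite_sub_hasSum hsum ⟨(k, n), hn⟩
  simp only [sub_self] at hsub
  rw [hY0] at hsub
  have hmain : TraceNormLE ((conjOp R T ^ n) x - A k) (2 * (1 / 2) ^ k) := by
    classical
    refine TraceNormLE.hasSum (r := fun p : {p : ℕ × ℕ // p.2 ∈ E p.1} =>
      if p = ⟨(k, n), hn⟩ then 0 else c p.1.1 (n - p.1.2)) (fun p => ?_) hsub fun F => ?_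
    · by_cases hp : p = ⟨(k, n), hn⟩
      · simp only [hp, if_true]
        exact TraceNormLE.zero le_rfl
      · simp only [hp, if_false]
        exact hYc _ _
    · rw [← Finset.sum_filter_add_sum_filter_not F (fun p => p = ⟨(k, n), hn⟩),
        Finset.sum_congr rfl fun p hp => if_pos (Finset.mem_filter.1 hp).2,
        Finset.sum_const_zero, zero_add,
        Finset.sum_congr rfl fun p hp => if_neg (Finset.mem_filter.1 hp).2]
      have := hE2 k n hn ((F.filter fun p => ¬ p = ⟨(k, n), hn⟩).map
        (Function.Embedding.subtype _)) fun p hp => by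
          obtain ⟨q, hq, rfl⟩ := Finset.mem_map.1 hp
          exact ⟨q.2, fun h => (Finset.mem_filter.1 hq).2 (Subtype.ext h)⟩
      rwa [Finset.sum_map] at this
  have hpow : 2 * (1 / 2 : ℝ) ^ k ≤ 2 * (1 / 2) ^ m :=
    mul_le_mul_of_nonneg_left (pow_le_pow_of_le_one (by norm_num) (by norm_num) hmk) zero_le_two
  have := (hmain.add hAk).add hL
  rw [sub_add_sub_cancel, sub_add_sub_cancel] at this
  exact this.mono (by linarith)

theorem approxNumber_sub_comm (S T : H →L[ℂ] H) (n : ℕ) :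
    approxNumber (n + 1) (S - T) = approxNumber (n + 1) (T - S) := by
  have key : ∀ A : H →L[ℂ] H, approxNumber (n + 1) (-A) ≤ approxNumber (n + 1) A := fun A => by
    have h := approxNumber_conjOp_le (-ContinuousLinearMap.id ℂ H) (ContinuousLinearMap.id ℂ H) A n
    have e : conjOp (-ContinuousLinearMap.id ℂ H) (ContinuousLinearMap.id ℂ H) A = -A := by
      ext x; simp [conjOp]
    rw [e, norm_neg] at h
    refine h.trans (mul_le_of_le_one_left (approxNumber_nonneg _ _) ?_)
    exact mul_le_one₀ ContinuousLinearMap.norm_id_le (norm_nonneg _) ContinuousLinearMap.norm_id_le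
  refine le_antisymm ?_ ?_
  · simpa using key (T - S)
  · simpa using key (S - T)

/-! ### Transfer to the three spaces -/

theorem isFrequentlyHypercyclic_of_traceNorm {X : Type*} [AddCommGroup X] [Module ℂ X]
    [TopologicalSpace X] {R T x : H →L[ℂ] H} (hx : ∀ S ∈ rankOneSums H, ∀ ε : ℝ, 0 < ε →
      ∃ E : Set ℕ, HasPosLowerDensity E ∧ ∀ n ∈ E, TraceNormLE ((conjOp R T ^ n) x - S) ε)
    {A : X →ₗ[ℂ] X} (hA : Continuous A) (ι : X → H →L[ℂ] H)
    (hι : ∀ y, ι (A y) = conjOp R T (ι y)) (y : X) (hy : ι y = x)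
    (hU : ∀ U : Set X, IsOpen U → U.Nonempty → ∃ S ∈ rankOneSums H, ∃ δ : ℝ, 0 < δ ∧
      ∀ z : X, TraceNormLE (ι z - S) δ → z ∈ U) : IsFrequentlyHypercyclic A := by
  refine ⟨hA, y, fun U hUo hUn => ?_⟩
  obtain ⟨S, hS, δ, hδ, h⟩ := hU U hUo hUn
  obtain ⟨E, hE, hES⟩ := hx S hS δ hδ
  have hpow : ∀ n, ι ((A ^ n) y) = (conjOp R T ^ n) x := fun n => by
    induction n with
    | zero => simpa using hy
    | succ n ih => rw [pow_succ', pow_succ', Module.End.mul_apply, Module.End.mul_apply, hι, ih]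
  exact hE.lowerDensity_pos fun n hn => h _ (by rw [hpow]; exact hES n hn)

theorem continuous_conjSchatten (p : ℝ) (hp : 1 ≤ p) (R T : H →L[ℂ] H) :
    Continuous (conjSchatten p hp R T) := by
  have hp0 : 0 < p := by linarith
  refine ⟨fun U hU S hS => ?_⟩
  obtain ⟨ε, hε, h⟩ := hU _ hS
  refine ⟨ε / (‖R‖ * ‖T‖ + 1), by positivity, fun A hA => h _ ?_⟩
  rw [← map_sub]
  refine lt_of_le_of_lt (b := (‖R‖ * ‖T‖ + 1) * ‖A - S‖) ?_ ?_
  · generalize A - S = B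
    have hB : Summable fun n : ℕ => approxNumber (n + 1) B.toCLM ^ p := B.2
    have hCB : Summable fun n : ℕ => approxNumber (n + 1) (conjOp R T B.toCLM) ^ p :=
      IsSchatten.conjOp hp R T B.2
    have hnn : 0 ≤ ∑' n : ℕ, approxNumber (n + 1) B.toCLM ^ p :=
      tsum_nonneg fun n => Real.rpow_nonneg (approxNumber_nonneg _ _) _
    have hle : ∑' n : ℕ, approxNumber (n + 1) (conjOp R T B.toCLM) ^ p
        ≤ (‖R‖ * ‖T‖ + 1) ^ p * ∑' n : ℕ, approxNumber (n + 1) B.toCLM ^ p := by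
      rw [← tsum_mul_left]
      refine Summable.tsum_le_tsum (fun n => ?_) hCB (hB.mul_left _)
      rw [← Real.mul_rpow (by positivity) (approxNumber_nonneg _ _)]
      refine Real.rpow_le_rpow (approxNumber_nonneg _ _)
        ((approxNumber_conjOp_le R T B.toCLM n).trans ?_) hp0.le
      exact mul_le_mul_of_nonneg_right (by linarith) (approxNumber_nonneg _ _)
    calc (∑' n : ℕ, approxNumber (n + 1) (conjOp R T B.toCLM) ^ p) ^ (1 / p)
        ≤ ((‖R‖ * ‖T‖ + 1) ^ p * ∑' n : ℕ, approxNumber (n + 1) B.toCLM ^ p) ^ (1 / p) :=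
          Real.rpow_le_rpow (tsum_nonneg fun n => Real.rpow_nonneg (approxNumber_nonneg _ _) _)
            hle (by positivity)
      _ = _ := by
          rw [Real.mul_rpow (by positivity) hnn, ← Real.rpow_mul (by positivity),
            mul_one_div_cancel hp0.ne', Real.rpow_one]
          rfl
  · rwa [lt_div_iff₀ (by positivity), mul_comm] at hA

variable [CompleteSpace H]

theorem SchattenClass.exists_traceNorm_ball_subset (p : ℝ) (hp : 1 ≤ p)
    (U : Set (SchattenClass H p hp)) (hU : IsOpen U) (hne : U.Nonempty) :
    ∃ S ∈ rankOneSums H, ∃ δ : ℝ, 0 < δ ∧ ∀ z : SchattenClass H p hp,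
      TraceNormLE (z.toCLM - S) δ → z ∈ U := by
  have hp0 : 0 < p := by linarith
  obtain ⟨A, hA⟩ := hne
  obtain ⟨ε, hε, h⟩ := hU A hA
  -- With two errors of size `η`, the quasi-triangle inequality gives `2 * 2 ^ p * 2 * η = ε ^ p /
  -- 2`. The radius `η ^ (1 / p) / 2` below is the `r` for which `(2 * r) ^ p = η`.
  set η : ℝ := ε ^ p / (8 * 2 ^ p) with hη
  have hη0 : 0 < η := by positivity
  have hAs : IsSchatten p A.toCLM := A.2
  obtain ⟨S, hS, hsum, hle⟩ := hAs.exists_rankOneSums hp hη0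
  refine ⟨S, hS, η ^ (1 / p) / 2, by positivity, fun z hz => h z ?_⟩
  have h1 : ∑' n : ℕ, approxNumber (n + 1) (z.toCLM - S) ^ p ≤ η := by
    refine (hz.tsum_approxNumber_rpow_le hp).trans (le_of_eq ?_)
    rw [mul_div_cancel₀ _ two_ne_zero, ← Real.rpow_mul hη0.le, one_div_mul_cancel hp0.ne',
      Real.rpow_one]
  have hneg : IsSchatten p (S - A.toCLM) := by
    simpa [IsSchatten, approxNumber_sub_comm S] using hsum
  have h2 : ∑' n : ℕ, approxNumber (n + 1) (S - A.toCLM) ^ p ≤ η := by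
    simpa [approxNumber_sub_comm S] using hle
  have h3 := (hz.isSchatten hp).tsum_add_le hp hneg
  rw [sub_add_sub_cancel] at h3
  have h4 : ∑' n : ℕ, approxNumber (n + 1) (z.toCLM - A.toCLM) ^ p < ε ^ p := by
    have h5 : 2 * 2 ^ p * (η + η) = ε ^ p / 2 := by
      rw [hη]; field_simp; ring
    have h6 : 0 < ε ^ p := by positivity
    have h7 := mul_le_mul_of_nonneg_left (add_le_add h1 h2) (by positivity : 0 ≤ 2 * (2 : ℝ) ^ p)
    linarith
  have h5 := Real.rpow_lt_rpow (tsum_nonneg fun n => Real.rpow_nonneg (approxNumber_nonneg _ _) _)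
    h4 (by positivity : 0 < 1 / p)
  rwa [← Real.rpow_mul hε.le, mul_one_div_cancel hp0.ne', Real.rpow_one] at h5

theorem compactOperator.exists_traceNorm_ball_subset
    (U : Set (compactOperator (RingHom.id ℂ) H H)) (hU : IsOpen U) (hne : U.Nonempty) :
    ∃ S ∈ rankOneSums H, ∃ δ : ℝ, 0 < δ ∧ ∀ z : compactOperator (RingHom.id ℂ) H H,
      TraceNormLE ((z : H →L[ℂ] H) - S) δ → z ∈ U := by
  obtain ⟨A, hA⟩ := hne
  obtain ⟨ε, hε, h⟩ := Metric.isOpen_iff.1 hU A hA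
  obtain ⟨S, hS, hle⟩ := IsCompactOperator.exists_rankOneSums_norm_sub_le (T := A.1) A.2
    (by positivity : 0 < ε / 3)
  refine ⟨S, hS, ε / 3, by positivity, fun z hz => h ?_⟩
  rw [Metric.mem_ball, dist_eq_norm, Submodule.coe_norm, Submodule.coe_sub]
  have h1 := norm_sub_le_norm_sub_add_norm_sub (z : H →L[ℂ] H) S A
  have h2 := hz.norm_le
  rw [norm_sub_rev] at hle
  linarith

/-- A basic neighbourhood tests `A` only on a compact set `K`. The image of `K` is totally bounded,
so projecting onto a suitable finite-dimensional space changes `A` little on `K`; elsewhere `A` is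
left uncontrolled. -/
theorem CompactConvergenceCLM.exists_traceNorm_ball_subset
    (U : Set (H →L_c[ℂ] H)) (hU : IsOpen U) (hne : U.Nonempty) :
    ∃ S ∈ rankOneSums H, ∃ δ : ℝ, 0 < δ ∧ ∀ z : H →L_c[ℂ] H,
      TraceNormLE ((show H →L[ℂ] H from z) - S) δ → z ∈ U := by
  obtain ⟨A, hA⟩ := hne
  obtain ⟨A', hA'⟩ : ∃ A' : H →L[ℂ] H, A' = A := ⟨A, rfl⟩
  have hnhds : (fun B : H →L_c[ℂ] H => B + A) ⁻¹' U ∈ nhds (0 : H →L_c[ℂ] H) :=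
    (hU.preimage (continuous_id.add continuous_const)).mem_nhds (by simpa using hA)
  obtain ⟨⟨K, ε⟩, ⟨hK, hε⟩, hsub⟩ :=
    (CompactConvergenceCLM.hasBasis_nhds_zero_of_basis Metric.nhds_basis_ball).mem_iff.1 hnhds
  have htb : TotallyBounded (Set.range fun x : K => A' x) := by
    refine (hK.image A'.continuous).totallyBounded.subset ?_
    rintro _ ⟨x, rfl⟩
    exact ⟨x, x.2, rfl⟩
  obtain ⟨S, hS, hle⟩ := TotallyBounded.exists_rankOneSums_norm_sub_le _ A' htb
    (by positivity : 0 < ε / 3)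
  obtain ⟨C, hC⟩ := hK.isBounded.exists_norm_le
  refine ⟨S, hS, ε / (3 * (|C| + 1)), by positivity, fun z hz => ?_⟩
  obtain ⟨z', hz'⟩ : ∃ z' : H →L[ℂ] H, z' = z := ⟨z, rfl⟩
  have hz : TraceNormLE (z' - S) (ε / (3 * (|C| + 1))) := by rw [hz']; exact hz
  have hmem : z - A ∈ (fun B : H →L_c[ℂ] H => B + A) ⁻¹' U := by
    refine hsub fun x hx => ?_
    have hzx : (z - A) x = z' x - A' x := by rw [hz', hA']; rfl
    rw [hzx, Metric.mem_ball, dist_zero_right]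
    have h1 := norm_sub_le_norm_sub_add_norm_sub (z' x) (S x) (A' x)
    have h2 : ‖A' x - S x‖ ≤ ε / 3 := hle ⟨x, hx⟩
    rw [norm_sub_rev] at h2
    have h3 : ‖z' x - S x‖ ≤ ε / 3 := by
      calc ‖(z' - S) x‖ ≤ ‖z' - S‖ * ‖x‖ := (z' - S).le_opNorm x
        _ ≤ ε / (3 * (|C| + 1)) * (|C| + 1) := by
            gcongr
            · exact hz.norm_le
            · exact (hC x hx).trans ((le_abs_self C).trans (by linarith))
        _ = ε / 3 := by field_simp
    have hε' : 0 < ε := hε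
    linarith
  simpa using hmem

/-- If the operators with summable two-sided orbits approximate all rank-one operators, then
`S ↦ R S T` is frequently hypercyclic on all three spaces. -/
theorem isFrequentlyHypercyclic_of_approximable [TopologicalSpace.SeparableSpace H]
    {R T : H →L[ℂ] H} (hRT : ∀ u v : H,
      IsTraceNormApproximable (HasSummableOrbit R T) (InnerProductSpace.rankOne ℂ u v)) :
    (∀ (p : ℝ) (hp : 1 ≤ p), IsFrequentlyHypercyclic (conjSchatten p hp R T)) ∧
      IsFrequentlyHypercyclic (conjCompact R T) ∧ IsFrequentlyHypercyclic (conjCOT R T) := by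
  obtain ⟨x, r, hxr, hx⟩ := exists_frequently_approximating hRT
  refine ⟨fun p hp => ?_, ?_, ?_⟩
  · exact isFrequentlyHypercyclic_of_traceNorm hx (continuous_conjSchatten p hp R T)
      SchattenClass.toCLM (fun _ => rfl)
      (show schattenSubmodule H p hp from ⟨x, hxr.isSchatten hp⟩) rfl
      (SchattenClass.exists_traceNorm_ball_subset p hp)
  · refine isFrequentlyHypercyclic_of_traceNorm hx ?_ Subtype.val (fun _ => rfl)
      ⟨x, hxr.isCompactOperator⟩ rfl compactOperator.exists_traceNorm_ball_subset
    have := continuous_conjOp_pow R T 1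
    rw [pow_one] at this
    exact (this.comp continuous_subtype_val).subtype_mk _
  · exact isFrequentlyHypercyclic_of_traceNorm hx
      ((ContinuousLinearMap.postcompCompactConvergenceCLM H R).comp
        (ContinuousLinearMap.precompCompactConvergenceCLM H T)).continuous
      (fun z => (show H →L[ℂ] H from z)) (fun _ => rfl) x rfl
      CompactConvergenceCLM.exists_traceNorm_ball_subset

end Criterion

/-! ### Vectors with absolutely summable two-sided orbits -/

section Orbits

open MeasureTheory FourierTransform

variable {H : Type*} [NormedAddCommGroup H] [InnerProductSpace ℂ H]

/-- The vectors which lie on an absolutely summable two-sided orbit of `A`. -/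
def summableOrbitVectors (A : H →L[ℂ] H) : Submodule ℂ H where
  carrier := {u | ∃ U : ℤ → H, U 0 = u ∧ (∀ n, A (U n) = U (n + 1)) ∧ Summable fun n => ‖U n‖}
  zero_mem' := ⟨fun _ => 0, rfl, fun _ => map_zero A, by simp⟩
  add_mem' := by
    rintro _ _ ⟨U, rfl, hU, hUs⟩ ⟨V, rfl, hV, hVs⟩
    exact ⟨fun n => U n + V n, rfl, fun n => by rw [map_add, hU, hV],
      (hUs.add hVs).of_nonneg_of_le (fun _ => norm_nonneg _) fun _ => norm_add_le _ _⟩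
  smul_mem' := by
    rintro c _ ⟨U, rfl, hU, hUs⟩
    exact ⟨fun n => c • U n, rfl, fun n => by rw [map_smul, hU],
      by simpa only [norm_smul] using hUs.mul_left ‖c‖⟩

theorem smul_eventuallyEq_zero {f : ℝ → ℝ} (E : ℝ → H) {t : ℝ} (ht : t ∉ tsupport f) :
    (fun t => f t • E t) =ᶠ[nhds t] fun _ => 0 := by
  filter_upwards [(isClosed_tsupport f).isOpen_compl.mem_nhds ht] with x hx
  rw [image_eq_zero_of_notMem_tsupport hx, zero_smul]

/-- Integrating a smooth field of eigenvectors against a test function gives a vector with an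
absolutely summable two-sided orbit. -/
theorem integral_smul_mem_summableOrbitVectors [CompleteSpace H] {A : H →L[ℂ] H} {E : ℝ → H}
    {f : ℝ → ℝ} (hf : ContDiff ℝ (⊤ : ℕ∞) f) (hfc : HasCompactSupport f)
    (hE : ∀ t ∈ tsupport f, ContDiffAt ℝ (⊤ : ℕ∞) E t)
    (hA : ∀ t ∈ tsupport f, A (E t) = Complex.exp (-2 * Real.pi * t * Complex.I) • E t) :
    ∫ t, f t • E t ∈ summableOrbitVectors A := by
  have hsm : ContDiff ℝ (⊤ : ℕ∞) fun t => f t • E t := by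
    refine contDiff_iff_contDiffAt.2 fun t => ?_
    by_cases ht : t ∈ tsupport f
    · exact hf.contDiffAt.smul (hE t ht)
    · exact contDiffAt_const.congr_of_eventuallyEq (smul_eventuallyEq_zero E ht)
  have hcs : HasCompactSupport fun t => f t • E t := hfc.smul_right
  set G : SchwartzMap ℝ H := hcs.toSchwartzMap hsm with hG
  have hGt : ∀ t, G t = f t • E t := fun t => rfl
  -- The eigenvalue `exp (-2πit)` under the integral shifts the Fourier variable by one, so `A` acts
  -- as a shift on the integer values. Schwartz decay of order `|n| ^ (-2)` gives summability.
  refine ⟨fun n => 𝓕 (G : ℝ → H) n, ?_, fun n => ?_, ?_⟩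
  · simp [Real.fourier_real_eq_integral_exp_smul, hGt]
  · simp only
    rw [Real.fourier_real_eq_integral_exp_smul, Real.fourier_real_eq_integral_exp_smul,
      ← ContinuousLinearMap.integral_comp_comm]
    · refine integral_congr_ae (Filter.Eventually.of_forall fun t => ?_)
      simp only [hGt]
      by_cases ht : t ∈ tsupport f
      · have hsm : ∀ x : H, f t • x = ((f t : ℝ) : ℂ) • x := fun x => (Complex.coe_smul _ _).symm
        simp only [hsm, map_smul, hA t ht, smul_smul]
        rw [mul_right_comm, ← Complex.exp_add]
        congr 3
        push_cast
        ring
      · rw [image_eq_zero_of_notMem_tsupport ht]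
        simp
    · have := (Real.fourierIntegral_convergent_iff (μ := volume) (f := (G : ℝ → H)) (n : ℝ)).2
        G.integrable
      refine this.congr (Filter.Eventually.of_forall fun t => ?_)
      simp only [Circle.smul_def, Real.fourierChar_apply]
      congr 2
      simp
      ring
  · have h1 := (𝓕 G).isBigO_cocompact_rpow (-2)
    have h2 := (h1.comp_tendsto Int.tendsto_coe_cofinite).norm_left
    exact summable_of_isBigO (Real.summable_abs_int_rpow (by norm_num : (1 : ℝ) < 2)) h2

/-- If a smooth field of unimodular eigenvectors spans a dense subspace, so that no nonzero vector
is orthogonal to it, then the vectors with absolutely summable two-sided orbits are dense. -/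
theorem dense_summableOrbitVectors [CompleteSpace H] {A : H →L[ℂ] H} {E : ℝ → H} {s : Set ℝ}
    (hs : IsOpen s) (hE : ∀ t ∈ s, ContDiffAt ℝ (⊤ : ℕ∞) E t)
    (hA : ∀ t ∈ s, A (E t) = Complex.exp (-2 * Real.pi * t * Complex.I) • E t)
    (htot : ∀ g : H, (∀ t ∈ s, inner ℂ g (E t) = 0) → g = 0) :
    Dense (summableOrbitVectors A : Set H) := by
  rw [Submodule.dense_iff_topologicalClosure_eq_top, Submodule.topologicalClosure_eq_top_iff,
    Submodule.eq_bot_iff]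
  intro g hg
  refine htot g ?_
  have hcont : ContinuousOn (fun t => inner ℂ g (E t)) s := fun t ht =>
    (continuousAt_const.inner (hE t ht).continuousAt).continuousWithinAt
  -- Orthogonality to every average `∫ f t • E t` makes `inner ℂ g (E t)` vanish as a distribution
  -- on `s`; continuity then removes the exceptional null set.
  have hae : ∀ᵐ t, t ∈ s → inner ℂ g (E t) = 0 := by
    refine hs.ae_eq_zero_of_integral_contDiff_smul_eq_zero
      (hcont.locallyIntegrableOn hs.measurableSet) fun f hf hfc hfs => ?_
    have hmem := integral_smul_mem_summableOrbitVectors (A := A) (E := E) hf hfc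
      (fun t ht => hE t (hfs ht)) (fun t ht => hA t (hfs ht))
    have h0 := Submodule.inner_left_of_mem_orthogonal hmem hg
    have hint : Integrable fun t => f t • E t := by
      refine Continuous.integrable_of_hasCompactSupport ?_ hfc.smul_right
      refine continuous_iff_continuousAt.2 fun t => ?_
      by_cases ht : t ∈ tsupport f
      · exact hf.continuous.continuousAt.smul (hE t (hfs ht)).continuousAt
      · exact continuousAt_const.congr (smul_eventuallyEq_zero E ht).symm
    rw [← integral_inner hint] at h0
    rw [← h0]
    refine integral_congr_ae (Filter.Eventually.of_forall fun t => ?_)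
    simp only
    rw [← Complex.coe_smul, ← Complex.coe_smul, inner_smul_right, smul_eq_mul]
  have := Measure.eqOn_open_of_ae_eq (μ := volume) (g := fun _ => (0 : ℂ))
    ((ae_restrict_iff' hs.measurableSet).2 hae) hs hcont continuousOn_const
  exact this

end Orbits

/-! ### Weighted Hardy spaces -/

section WeightedHardySpace

open ComplexConjugate Filter Topology

variable {H : Type*} [NormedAddCommGroup H] [InnerProductSpace ℂ H] [CompleteSpace H]
    [RKHS ℂ H 𝔻 ℂ]

variable (H) in
/-- The reproducing kernel at `z`. -/
noncomputable def kernelVector (z : 𝔻) : H := RKHS.kerFun H z 1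

theorem inner_kernelVector (z : 𝔻) (f : H) : inner ℂ (kernelVector H z) f = f z := by
  simp [kernelVector]

theorem adjoint_kernelVector {φ : 𝔻 → ℂ} {M : H →L[ℂ] H} (hM : IsMultiplicationOperator φ M)
    (z : 𝔻) : ContinuousLinearMap.adjoint M (kernelVector H z) = conj (φ z) • kernelVector H z := by
  refine ext_inner_right ℂ fun f => ?_
  rw [ContinuousLinearMap.adjoint_inner_left, inner_kernelVector, hM, inner_smul_left,
    inner_kernelVector, Complex.conj_conj]

theorem IsWeightedHardySpace.separableSpace {β : ℕ → ℝ} (hH : IsWeightedHardySpace β H) :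
    TopologicalSpace.SeparableSpace H := by
  obtain ⟨e, -⟩ := hH.exists_basis
  have h := (TopologicalSpace.IsSeparable.span (R := ℂ)
    (Set.countable_range e).isSeparable).closure
  rw [← Submodule.topologicalClosure_coe, e.dense_span] at h
  exact TopologicalSpace.isSeparable_univ_iff.1 h

/-- The reproducing kernel is an antianalytic function. -/
theorem IsWeightedHardySpace.exists_analytic_kernel {β : ℕ → ℝ} (hH : IsWeightedHardySpace β H) :
    ∃ K : ℂ → H, AnalyticOnNhd ℂ K (Metric.ball 0 1) ∧ ∀ z : 𝔻, kernelVector H z = K (conj z) := by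
  obtain ⟨e, he⟩ := hH.exists_basis
  set p : FormalMultilinearSeries ℂ ℂ H := fun n =>
    ContinuousMultilinearMap.mkPiRing ℂ (Fin n) ((β n : ℂ) • e n) with hp
  have hpn : ∀ n (ζ : ℂ), p n (fun _ => ζ) = ζ ^ n • ((β n : ℂ) • e n) := fun n ζ => by
    simp [hp]
  have hsum : ∀ z : 𝔻, HasSum (fun n => p n fun _ => conj (z : ℂ)) (kernelVector H z) := fun z => by
    convert e.hasSum_repr (kernelVector H z) using 2 with n
    rw [hpn, HilbertBasis.repr_apply_apply, ← inner_conj_symm, inner_kernelVector, he, smul_smul]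
    simp [mul_comm]
  -- The kernel expands as `∑ conj z ^ n • β_n • e_n` at every point of the disc; at a real `r < 1`
  -- its terms tend to `0`, which bounds the radius from below.
  have hrad : 1 ≤ p.radius := by
    refine ENNReal.le_of_forall_nnreal_lt fun r hr => ?_
    have hr1 : (r : ℝ) < 1 := by exact_mod_cast hr
    refine p.le_radius_of_tendsto (l := 0) ?_
    have h := (hsum (.mk (r : ℂ) (by simpa using hr1))).summable.tendsto_atTop_zero.norm
    rw [norm_zero] at h
    refine h.congr fun n => ?_
    rw [hpn, hp, ContinuousMultilinearMap.norm_mkPiRing, norm_smul, mul_comm]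
    simp
  have hfp := p.hasFPowerSeriesOnBall (lt_of_lt_of_le one_pos hrad)
  refine ⟨p.sum, fun ζ hζ => hfp.analyticOnNhd ζ ?_, fun z => (hsum z).tsum_eq.symm⟩
  refine Metric.eball_subset_eball hrad ?_
  rw [Metric.mem_eball, edist_zero_right]
  rw [mem_ball_zero_iff] at hζ
  rw [enorm_eq_nnnorm]
  exact_mod_cast hζ

theorem IsWeightedHardySpace.eq_zero_of_frequently {β : ℕ → ℝ} (hH : IsWeightedHardySpace β H)
    {g : H} {z₀ : ℂ} (hz₀ : ‖z₀‖ < 1)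
    (h : ∃ᶠ z in 𝓝[≠] z₀, ∃ hz : ‖z‖ < 1, g (.mk z hz) = 0) : g = 0 := by
  obtain ⟨F, hF, hgF⟩ := hH.analytic g
  have hF0 := hF.eqOn_zero_of_preconnected_of_frequently_eq_zero
    (convex_ball (0 : ℂ) 1).isPreconnected (by simpa using hz₀) (h.mono fun z ⟨hz, hgz⟩ => by
      rw [hgF] at hgz
      exact hgz)
  refine RKHS.ext fun z => ?_
  rw [hgF, hF0 (by simpa using z.norm_lt_one)]
  simp

theorem IsWeightedHardySpace.dense_span_kernelVector {β : ℕ → ℝ} (hH : IsWeightedHardySpace β H)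
    (w₀ : 𝔻) {N : Set ℂ} (hN : N ∈ 𝓝 (w₀ : ℂ)) :
    Dense (Submodule.span ℂ {k | ∃ w : 𝔻, (w : ℂ) ∈ N ∧ k = kernelVector H w} : Set H) := by
  rw [Submodule.dense_iff_topologicalClosure_eq_top, Submodule.topologicalClosure_eq_top_iff,
    Submodule.eq_bot_iff]
  intro g hg
  have hev : ∀ᶠ z in 𝓝 (w₀ : ℂ), ∃ hz : ‖z‖ < 1, g (.mk z hz) = 0 := by
    filter_upwards [hN, Metric.isOpen_ball.mem_nhds (show (w₀ : ℂ) ∈ Metric.ball 0 1 by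
      simpa using w₀.norm_lt_one)] with z hzN hz
    have hz1 : ‖z‖ < 1 := by simpa using hz
    refine ⟨hz1, ?_⟩
    rw [← inner_kernelVector]
    have hmem : kernelVector H (.mk z hz1) ∈
        Submodule.span ℂ {k | ∃ w : 𝔻, (w : ℂ) ∈ N ∧ k = kernelVector H w} :=
      Submodule.subset_span ⟨_, by simpa using hzN, rfl⟩
    exact Submodule.inner_right_of_mem_orthogonal hmem hg
  exact hH.eq_zero_of_frequently w₀.norm_lt_one (hev.filter_mono nhdsWithin_le_nhds).frequently

/-- A nonconstant analytic function takes values of the modulus `‖F z₀‖ ≠ 0` at points where its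
derivative does not vanish. -/
theorem exists_norm_eq_deriv_ne_zero {F : ℂ → ℂ} {U : Set ℂ} (hU : IsOpen U)
    (hUc : IsPreconnected U) (hF : AnalyticOnNhd ℂ F U) (hconst : ¬ ∃ c, ∀ z ∈ U, F z = c) {z₀ : ℂ}
    (hz₀ : z₀ ∈ U) (hF0 : F z₀ ≠ 0) : ∃ z₁ ∈ U, ‖F z₁‖ = ‖F z₀‖ ∧ deriv F z₁ ≠ 0 := by
  have hnc : ¬ ∀ᶠ z in 𝓝 z₀, F z = F z₀ := fun h => hconst ⟨F z₀, fun _ hz =>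
    hF.eqOn_of_preconnected_of_eventuallyEq analyticOnNhd_const hUc hz₀ h hz⟩
  have hopen := (hF z₀ hz₀).eventually_constant_or_nhds_le_map_nhds.resolve_left hnc
  have hder : ∀ᶠ z in 𝓝[≠] z₀, deriv F z ≠ 0 := by
    refine ((hF z₀ hz₀).deriv.eventually_eq_zero_or_eventually_ne_zero).resolve_left fun h => ?_
    obtain ⟨ε, hε, hball⟩ := Metric.eventually_nhds_iff_ball.1
      (h.and (hU.eventually_mem hz₀))
    refine hnc (Metric.eventually_nhds_iff_ball.2 ⟨ε, hε, fun z hz => ?_⟩)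
    exact (Metric.isOpen_ball).is_const_of_deriv_eq_zero (convex_ball z₀ ε).isPreconnected
      (fun w hw => (hF w (hball w hw).2).differentiableAt.differentiableWithinAt)
      (fun w hw => (hball w hw).1) hz (Metric.mem_ball_self hε)
  have hs : {z | z ∈ U ∧ (z ≠ z₀ → deriv F z ≠ 0)} ∈ 𝓝 z₀ :=
    Filter.inter_mem (hU.mem_nhds hz₀) (eventually_nhdsWithin_iff.1 hder)
  have him := hopen (image_mem_map hs)
  -- Rotating the value `F z₀` slightly keeps its modulus but changes the value. By the open mapping
  -- theorem it is taken near `z₀` at a point other than `z₀`, where the derivative is nonzero.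
  have hd : HasDerivAt (fun t : ℝ => F z₀ * Complex.exp (t * Complex.I))
      (F z₀ * (Complex.exp ((0 : ℝ) * Complex.I) * (1 * Complex.I))) 0 :=
    (((hasDerivAt_id (0 : ℝ)).ofReal_comp.mul_const Complex.I).cexp).const_mul _
  have hne := hd.eventually_ne (c := F z₀) (by simpa using hF0)
  have hcont : Tendsto (fun t : ℝ => F z₀ * Complex.exp (t * Complex.I)) (𝓝[≠] 0) (𝓝 (F z₀)) := by
    have := hd.continuousAt.tendsto
    simp only [Complex.ofReal_zero, zero_mul, Complex.exp_zero, mul_one] at this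
    exact this.mono_left nhdsWithin_le_nhds
  obtain ⟨t, ht1, z₁, hz₁, ht2⟩ := (hne.and (hcont him)).exists
  refine ⟨z₁, hz₁.1, ?_, hz₁.2 fun h => ht1 ?_⟩
  · rw [ht2, norm_mul, Complex.norm_exp_ofReal_mul_I, mul_one]
  · rw [h] at ht2
    exact ht2.symm

/-- Near a unimodular value `c * conj (φ z₀)`, the adjoint of multiplication by a nonconstant `φ`,
multiplied by `c`, has plenty of vectors with absolutely summable two-sided orbits. -/
theorem IsWeightedHardySpace.dense_summableOrbitVectors_adjoint {β : ℕ → ℝ}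
    (hH : IsWeightedHardySpace β H) {φ : 𝔻 → ℂ} (hφ : IsAnalyticOnDisc φ) {M : H →L[ℂ] H}
    (hM : IsMultiplicationOperator φ M) (hnc : ¬ ∃ c : ℂ, ∀ z, φ z = c) (c : ℂ) (z₀ : 𝔻)
    (h1 : ‖c * φ z₀‖ = 1) :
    Dense (summableOrbitVectors (c • ContinuousLinearMap.adjoint M) : Set H) := by
  obtain ⟨F, hF, hφF⟩ := hφ
  obtain ⟨K, hK, hkK⟩ := hH.exists_analytic_kernel
  have hc0 : c ≠ 0 := fun h => by simp [h] at h1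
  have hmem : ∀ z : 𝔻, (z : ℂ) ∈ Metric.ball (0 : ℂ) 1 := fun z => by simpa using z.norm_lt_one
  rw [hφF] at h1
  obtain ⟨z₁, hz₁, hnorm, hder⟩ := exists_norm_eq_deriv_ne_zero Metric.isOpen_ball
    (convex_ball (0 : ℂ) 1).isPreconnected hF (fun ⟨a, ha⟩ => hnc ⟨a, fun z => by
      rw [hφF, ha _ (hmem z)]⟩) (hmem z₀) (fun h => by simp [h] at h1)
  have h1' : ‖c * conj (F z₁)‖ = 1 := by
    rw [norm_mul, RCLike.norm_conj, hnorm, ← norm_mul, h1]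
  -- a branch of the curve on which the eigenvalue is unimodular
  set q : ℝ → ℂ := fun t => conj (Complex.exp (-2 * Real.pi * t * Complex.I) / c) with hq
  obtain ⟨t₁, ht₁⟩ : ∃ t₁, q t₁ = F z₁ := by
    refine ⟨-Complex.arg (c * conj (F z₁)) / (2 * Real.pi), ?_⟩
    have h := Complex.norm_mul_exp_arg_mul_I (c * conj (F z₁))
    rw [h1', Complex.ofReal_one, one_mul] at h
    have h2 : (-2 * Real.pi * ((-Complex.arg (c * conj (F z₁)) / (2 * Real.pi) : ℝ) : ℂ)
        * Complex.I) = Complex.arg (c * conj (F z₁)) * Complex.I := by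
      push_cast
      field_simp
    simp only [hq]
    rw [h2, h, mul_div_cancel_left₀ _ hc0, Complex.conj_conj]
  have hqd : HasDerivAt (fun t : ℝ => Complex.exp (-2 * Real.pi * t * Complex.I))
      (Complex.exp (-2 * Real.pi * t₁ * Complex.I) * (-2 * Real.pi * 1 * Complex.I)) t₁ :=
    ((((hasDerivAt_id t₁).ofReal_comp).const_mul (-2 * Real.pi : ℂ)).mul_const Complex.I).cexp
  have hqne : ∀ᶠ t in 𝓝[≠] t₁, q t ≠ F z₁ := by
    filter_upwards [hqd.eventually_ne (c := Complex.exp (-2 * Real.pi * t₁ * Complex.I))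
      (by simp [Real.pi_ne_zero])] with t ht h
    rw [← ht₁] at h
    have h3 := (starRingEnd ℂ).injective h
    exact ht ((div_left_inj' hc0).1 h3)
  have hqan : AnalyticAt ℝ q t₁ := by
    have h3 : AnalyticAt ℝ (fun t : ℝ => Complex.exp (-2 * Real.pi * t * Complex.I) / c) t₁ := by
      have h4 : AnalyticAt ℝ (fun t : ℝ => (t : ℂ)) t₁ := Complex.ofRealCLM.analyticAt t₁
      have h5 : AnalyticAt ℂ (fun ζ : ℂ => Complex.exp (-2 * Real.pi * ζ * Complex.I) / c) (t₁ : ℂ) := by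
        fun_prop
      exact h5.restrictScalars.comp h4
    exact (Complex.conjCLE.toContinuousLinearMap.analyticAt _).comp h3
  set G := (hF z₁ hz₁).hasStrictDerivAt.localInverse _ _ _ hder with hGdef
  have hGan : AnalyticAt ℂ G (F z₁) := (hF z₁ hz₁).analyticAt_localInverse hder
  have hG1 : G (F z₁) = z₁ := HasStrictFDerivAt.localInverse_apply_image ..
  have hGr : ∀ᶠ y in 𝓝 (F z₁), F (G y) = y := HasStrictDerivAt.eventually_right_inverse ..
  -- The inverse branch gives `F (Z t) = q t`, that is, `c * conj (F (Z t)) = exp (-2πit)`. The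
  -- field of eigenvectors is the kernel at `Z t`.
  set Z : ℝ → ℂ := fun t => G (q t) with hZ
  have hZ1 : Z t₁ = z₁ := by simp only [hZ]; rw [ht₁, hG1]
  have hZan : AnalyticAt ℝ Z t₁ := by
    rw [← ht₁] at hGan
    exact hGan.restrictScalars.comp hqan
  have hEan : AnalyticAt ℝ (fun t => K (conj (Z t))) t₁ := by
    have h3 : AnalyticAt ℝ (fun t => conj (Z t)) t₁ :=
      (Complex.conjCLE.toContinuousLinearMap.analyticAt _).comp hZan
    have h4 : AnalyticAt ℂ K (conj (Z t₁)) := hK _ (by rw [hZ1]; simpa using hz₁)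
    exact (h4.restrictScalars (𝕜 := ℝ)).comp_of_eq h3 rfl
  have hev : ∀ᶠ t in 𝓝 t₁, AnalyticAt ℝ (fun t => K (conj (Z t))) t ∧ ‖Z t‖ < 1 ∧
      F (Z t) = q t := by
    refine hEan.eventually_analyticAt.and (Eventually.and ?_ ?_)
    · refine (hZan.continuousAt.norm).eventually (gt_mem_nhds ?_)
      simp only
      rw [hZ1]
      simpa using hz₁
    · rw [← ht₁] at hGr
      exact hqan.continuousAt.eventually hGr
  obtain ⟨s, hs, hso, hst⟩ := eventually_nhds_iff.1 hev
  refine dense_summableOrbitVectors (E := fun t => K (conj (Z t))) hso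
    (fun t ht => (hs t ht).1.contDiffAt) (fun t ht => ?_) fun g hg => ?_
  · obtain ⟨-, hlt, hFq⟩ := hs t ht
    have hk := hkK (.mk (Z t) hlt)
    rw [Complex.UnitDisc.coe_mk] at hk
    rw [← hk, smul_apply, adjoint_kernelVector hM, hφF, Complex.UnitDisc.coe_mk, hFq,
      smul_smul]
    simp only [hq]
    rw [Complex.conj_conj, mul_div_cancel₀ _ hc0]
  -- `Z t` tends to `z₁` without taking this value, as `q t ≠ F z₁` for `t ≠ t₁` nearby. A vector
  -- orthogonal to the field thus has zeros accumulating at `z₁`.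
  · have htend : Tendsto Z (𝓝[≠] t₁) (𝓝[≠] z₁) := by
      refine tendsto_nhdsWithin_iff.2 ⟨?_, ?_⟩
      · rw [← hZ1]
        exact hZan.continuousAt.tendsto.mono_left nhdsWithin_le_nhds
      · filter_upwards [hqne, hev.filter_mono nhdsWithin_le_nhds] with t ht1 ht2 h
        rw [Set.mem_singleton_iff] at h
        rw [← ht2.2.2, h] at ht1
        exact ht1 rfl
    refine hH.eq_zero_of_frequently (z₀ := z₁) (by simpa using hz₁) (htend.frequently ?_)
    refine Eventually.frequently ?_
    filter_upwards [mem_nhdsWithin_of_mem_nhds (hso.mem_nhds hst)] with t ht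
    obtain ⟨-, hlt, -⟩ := hs t ht
    refine ⟨hlt, ?_⟩
    have hk := hkK (.mk (Z t) hlt)
    rw [Complex.UnitDisc.coe_mk] at hk
    have := hg t ht
    rw [← hk] at this
    rw [← inner_kernelVector, inner_eq_zero_symm]
    exact this

end WeightedHardySpace

/-! ### Rank-one operators with summable two-sided orbits -/

section RankOneOrbits

open InnerProductSpace ComplexConjugate Filter Topology

variable {H : Type*} [NormedAddCommGroup H] [InnerProductSpace ℂ H]

theorem isTraceNormApproximable_rankOne_left {P : (H →L[ℂ] H) → Prop} {D : Set H} (hD : Dense D)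
    {v : H} (h : ∀ u ∈ D, P (rankOne ℂ u v)) (u : H) :
    IsTraceNormApproximable P (rankOne ℂ u v) := fun ε hε => by
  have hcont : Continuous fun u' : H => ‖u' - u‖ * ‖v‖ + ‖u‖ * ‖v - v‖ := by fun_prop
  obtain ⟨u', hu', hD'⟩ := hD.inter_open_nonempty _ (isOpen_Iio.preimage hcont : IsOpen
    ((fun u' : H => ‖u' - u‖ * ‖v‖ + ‖u‖ * ‖v - v‖) ⁻¹' Set.Iio ε)) ⟨u, by simpa⟩
  exact ⟨_, h u' hD', (traceNormLE_rankOne_sub u v u' v).mono (le_of_lt hu')⟩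

theorem isTraceNormApproximable_rankOne_right {P : (H →L[ℂ] H) → Prop} {D : Set H} (hD : Dense D)
    {u : H} (h : ∀ v ∈ D, P (rankOne ℂ u v)) (v : H) :
    IsTraceNormApproximable P (rankOne ℂ u v) := fun ε hε => by
  have hcont : Continuous fun v' : H => ‖u - u‖ * ‖v'‖ + ‖u‖ * ‖v' - v‖ := by fun_prop
  obtain ⟨v', hv', hD'⟩ := hD.inter_open_nonempty _ (isOpen_Iio.preimage hcont : IsOpen
    ((fun v' : H => ‖u - u‖ * ‖v'‖ + ‖u‖ * ‖v' - v‖) ⁻¹' Set.Iio ε)) ⟨v, by simpa⟩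
  exact ⟨_, h v' hD', (traceNormLE_rankOne_sub u v u v').mono (le_of_lt hv')⟩

/-- Approximability of rank-one operators passes from a set of right factors to its span. -/
theorem isTraceNormApproximable_rankOne_span {P : (H →L[ℂ] H) → Prop} (h0 : P 0)
    (hadd : ∀ A B, P A → P B → P (A + B)) {D : Set H}
    (h : ∀ v ∈ D, ∀ u, IsTraceNormApproximable P (rankOne ℂ u v)) {v : H}
    (hv : v ∈ Submodule.span ℂ D) (u : H) : IsTraceNormApproximable P (rankOne ℂ u v) := by
  -- `u` must vary, because a scalar on the right factor is moved to the left one.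
  induction hv using Submodule.span_induction generalizing u with
  | mem v hv => exact h v hv u
  | zero => simpa using IsTraceNormApproximable.zero h0
  | add v w _ _ hv hw => rw [map_add]; exact (hv u).add hadd (hw u)
  | smul c v _ hv =>
    have e : rankOne ℂ u (c • v) = rankOne ℂ (conj c • u) v := by
      ext x; simp [smul_smul, mul_comm]
    rw [e]
    exact hv _

variable [CompleteSpace H]

theorem conjOp_rankOne (R T : H →L[ℂ] H) (u v : H) :
    conjOp R T (rankOne ℂ u v) = rankOne ℂ (R u) (ContinuousLinearMap.adjoint T v) := by
  ext x
  simp [conjOp, ContinuousLinearMap.adjoint_inner_left]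

/-- The eigenvalue `conj c` of the frozen right factor leaves the conjugate-linear slot as `c`, so
the left factor evolves under `c • R`. -/
theorem hasSummableOrbit_rankOne_left {R T : H →L[ℂ] H} {u v : H} {c : ℂ}
    (hv : ContinuousLinearMap.adjoint T v = conj c • v) (hu : u ∈ summableOrbitVectors (c • R)) :
    HasSummableOrbit R T (rankOne ℂ u v) := by
  obtain ⟨U, rfl, hU, hUs⟩ := hu
  refine ⟨fun n => rankOne ℂ (U n) v, fun n => ‖U n‖ * ‖v‖, rfl, fun n => ?_, hUs.mul_right _,
    fun n => TraceNormLE.rankOne _ _⟩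
  simp only
  rw [conjOp_rankOne, hv, ← hU n]
  ext x
  simp [smul_smul]

theorem hasSummableOrbit_rankOne_right {R T : H →L[ℂ] H} {u v : H} {c : ℂ}
    (hu : R u = conj c • u)
    (hv : v ∈ summableOrbitVectors (c • ContinuousLinearMap.adjoint T)) :
    HasSummableOrbit R T (rankOne ℂ u v) := by
  obtain ⟨V, rfl, hV, hVs⟩ := hv
  refine ⟨fun n => rankOne ℂ u (V n), fun n => ‖u‖ * ‖V n‖, rfl, fun n => ?_, hVs.mul_left _,
    fun n => TraceNormLE.rankOne _ _⟩
  simp only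
  rw [conjOp_rankOne, hu, ← hV n]
  ext x
  simp [smul_smul]

variable [RKHS ℂ H 𝔻 ℂ]

theorem IsWeightedHardySpace.isTraceNormApproximable_rankOne_of_left {β : ℕ → ℝ}
    (hH : IsWeightedHardySpace β H) {φ ψ : 𝔻 → ℂ} (hφ : IsAnalyticOnDisc φ)
    (hψ : IsAnalyticOnDisc ψ) {Mφ Mψ : H →L[ℂ] H} (hMφ : IsMultiplicationOperator φ Mφ)
    (hMψ : IsMultiplicationOperator ψ Mψ) (hnc : ¬ ∃ c : ℂ, ∀ z, φ z = c) {z₀ w₀ : 𝔻}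
    (hone : ‖φ z₀ * ψ w₀‖ = 1) (u v : H) :
    IsTraceNormApproximable (HasSummableOrbit (ContinuousLinearMap.adjoint Mφ) Mψ)
      (rankOne ℂ u v) := by
  obtain ⟨F, hF, hφF⟩ := id hφ
  obtain ⟨G, hG, hψG⟩ := hψ
  have hmem : ∀ z : 𝔻, (z : ℂ) ∈ Metric.ball (0 : ℂ) 1 := fun z => by simpa using z.norm_lt_one
  have hψ0 : G w₀ ≠ 0 := fun h => by rw [hψG, h] at hone; simp at hone
  have hopen : 𝓝 (F z₀) ≤ map F (𝓝 (z₀ : ℂ)) := by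
    refine (hF z₀ (hmem z₀)).eventually_constant_or_nhds_le_map_nhds.resolve_left fun h => ?_
    refine hnc ⟨F z₀, fun z => ?_⟩
    rw [hφF]
    exact hF.eqOn_of_preconnected_of_eventuallyEq analyticOnNhd_const
      (convex_ball (0 : ℂ) 1).isPreconnected (hmem z₀) h (hmem z)
  have himage : F '' Metric.ball 0 1 ∈ 𝓝 (F z₀) :=
    hopen (image_mem_map (Metric.isOpen_ball.mem_nhds (hmem z₀)))
  have hcont : Tendsto (fun w => F z₀ * G w₀ / G w) (𝓝 (w₀ : ℂ)) (𝓝 (F z₀)) := by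
    have h := tendsto_const_nhds (x := F z₀ * G w₀).div (hG w₀ (hmem w₀)).continuousAt.tendsto hψ0
    rwa [mul_div_cancel_right₀ _ hψ0] at h
  -- For `w` near `w₀` the open mapping theorem provides `z` with `φ z * ψ w = φ z₀ * ψ w₀`, still
  -- unimodular. The kernels at these `w` have a dense span and serve as frozen right factors.
  have hN : {w : ℂ | G w ≠ 0 ∧ F z₀ * G w₀ / G w ∈ F '' Metric.ball 0 1} ∈ 𝓝 (w₀ : ℂ) := by
    exact ((hG w₀ (hmem w₀)).continuousAt.eventually_ne hψ0).and (hcont.eventually_mem himage)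
  refine (isTraceNormApproximable_rankOne_right (hH.dense_span_kernelVector w₀ hN)
    (fun v hv => isTraceNormApproximable_rankOne_span (HasSummableOrbit.zero _ _)
      (fun _ _ => HasSummableOrbit.add) ?_ hv u) v).trans fun _ h => h
  rintro _ ⟨w, ⟨hw0, z, hz, hzw⟩, rfl⟩ u
  refine isTraceNormApproximable_rankOne_left (hH.dense_summableOrbitVectors_adjoint hφ hMφ hnc
    (ψ w) (.mk z (by simpa using hz)) ?_) (fun u hu => hasSummableOrbit_rankOne_left
      (adjoint_kernelVector hMψ w) hu) u
  rw [hφF, Complex.UnitDisc.coe_mk, hzw, hψG, mul_div_cancel₀ _ hw0, ← hφF, ← hψG, hone]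

/-- For constant `φ` the adjoint of `M_φ` is a scalar, so every `u` is an eigenvector and can be
frozen; the right factor then moves under `d • M_ψ*`. -/
theorem IsWeightedHardySpace.isTraceNormApproximable_rankOne_of_right {β : ℕ → ℝ}
    (hH : IsWeightedHardySpace β H) {ψ : 𝔻 → ℂ} {d : ℂ} (hψ : IsAnalyticOnDisc ψ)
    {Mφ Mψ : H →L[ℂ] H} (hMφ : IsMultiplicationOperator (fun _ => d) Mφ)
    (hMψ : IsMultiplicationOperator ψ Mψ) (hnc : ¬ ∃ c : ℂ, ∀ z, ψ z = c) {w₀ : 𝔻}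
    (hone : ‖d * ψ w₀‖ = 1) (u v : H) :
    IsTraceNormApproximable (HasSummableOrbit (ContinuousLinearMap.adjoint Mφ) Mψ)
      (rankOne ℂ u v) := by
  have hMu : ContinuousLinearMap.adjoint Mφ u = conj d • u := by
    refine ext_inner_right ℂ fun f => ?_
    have hf : Mφ f = d • f := RKHS.ext fun z => by rw [hMφ]; simp
    rw [ContinuousLinearMap.adjoint_inner_left, hf, inner_smul_left, inner_smul_right,
      Complex.conj_conj]
  exact isTraceNormApproximable_rankOne_right
    (hH.dense_summableOrbitVectors_adjoint hψ hMψ hnc d w₀ hone)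
    (fun v hv => hasSummableOrbit_rankOne_right hMu hv) v

end RankOneOrbits

theorem mainTheorem3 {H : Type*} [NormedAddCommGroup H] [InnerProductSpace ℂ H] [CompleteSpace H]
    [RKHS ℂ H 𝔻 ℂ] (β : ℕ → ℝ) (hH : IsWeightedHardySpace β H)
    (φ ψ : 𝔻 → ℂ) (hφ : IsAnalyticOnDisc φ) (hψ : IsAnalyticOnDisc ψ) (hφ0 : φ ≠ 0) (hψ0 : ψ ≠ 0)
    (Mφ Mψ : H →L[ℂ] H) (hMφ : IsMultiplicationOperator φ Mφ) (hMψ : IsMultiplicationOperator ψ Mψ)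
    (hnonconst : (¬ ∃ c : ℂ, ∀ z, φ z = c) ∨ (¬ ∃ c : ℂ, ∀ z, ψ z = c))
    (hone : ∃ z w : 𝔻, ‖φ z * ψ w‖ = 1) :
    (∀ (p : ℝ) (hp : 1 ≤ p),
      IsFrequentlyHypercyclic (conjSchatten p hp (ContinuousLinearMap.adjoint Mφ) Mψ)) ∧
    IsFrequentlyHypercyclic (conjCompact (ContinuousLinearMap.adjoint Mφ) Mψ) ∧
    IsFrequentlyHypercyclic (conjCOT (ContinuousLinearMap.adjoint Mφ) Mψ) := by
  have := hH.separableSpace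
  obtain ⟨z₀, w₀, h1⟩ := hone
  refine isFrequentlyHypercyclic_of_approximable fun u v => ?_
  by_cases hc : ∃ c : ℂ, ∀ z, φ z = c
  · obtain ⟨d, hd⟩ := id hc
    obtain rfl : φ = fun _ => d := funext hd
    exact hH.isTraceNormApproximable_rankOne_of_right hψ hMφ hMψ
      (hnonconst.resolve_left (not_not.2 hc)) h1 u v
  · exact hH.isTraceNormApproximable_rankOne_of_left hφ hψ hMφ hMψ hc h1 u v
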